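/- Let $n\ge 2$. For $f\in L^2(\mathbb{R}^n)$ (complex valued), a solution of $$ i\,\partial_t u=-\Delta u+|x|^2u \ \text{ in } \mathbb{R}^{n+1},\qquad u(\cdot,0)=f, \tag{1} $$ means a function $u\in C(\mathbb{R};L^2(\mathbb{R}^n))$ with $u(\cdot,0)=f$ such that for every Schwartz function $\varphi\in\mathcal{S}(\mathbb{R}^n)$ and every $t\in\mathbb{R}$ the function $s\mapsto\int_{\mathbb{R}^n}u(x,s)\varphi(x)\,dx$ is differentiable at $t$ and $$ i\,\frac{d}{dt}\int_{\mathbb{R}^n}u(x,t)\varphi(x)\,dx=\int_{\mathbb{R}^n}u(x,t)\,(-\Delta+|x|^2)\varphi(x)\,dx . $$ For every $f\in L^2(\mathbb{R}^n)$ there is exactly one solution $u$ of (1). Moreover, for every $\delta\in[0,1)$ there is a constant $C$, depending only on $n$ and $\delta$, such that for every $f\in L^2(\mathbb{R}^n)$ the solution $u$ of (1) satisfies $$ \int_0^{2\pi}\!\int_{\mathbb{R}^n}\frac{|u(x,t)|^2}{(x_1^2+x_2^2)^{\delta}}\,dx\,dt\le C\|f\|_2^2 . $$ Consequently, if $n\ge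 3$, then for every $\delta\in[0,1)$ there is a constant $C$, depending only on $n$ and $\delta$, such that for all pairwise distinct indices $i,j,k\in\{1,\dots,n\}$, every $f\in L^2(\mathbb{R}^n)$, and the solution $u$ of (1), $$ \int_0^{2\pi}\!\int_{\mathbb{R}^n}\frac{|u(x,t)|^2}{(x_i^2+x_j^2+x_k^2)^{\delta}}\,dx\,dt\le C\|f\|_2^2 . $$ -/

import Mathlib

open MeasureTheory Laplacian SchwartzMap
open scoped ENNReal NNReal

/-- The Hilbert space `L²(ℝⁿ)` of complex-valued functions (with Lebesgue measure). -/
abbrev L2 (n : ℕ) : Type := Lp ℂ 2 (volume : Measure (EuclideanSpace ℝ (Fin n)))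

/-- The Hermite operator (harmonic oscillator) `(-Δ + |x|²) φ` applied to a Schwartz function,
evaluated at `x`. -/
noncomputable def hermiteOp {n : ℕ} (φ : 𝓢(EuclideanSpace ℝ (Fin n), ℂ))
    (x : EuclideanSpace ℝ (Fin n)) : ℂ :=
  -(Δ φ) x + ((‖x‖ ^ 2 : ℝ) : ℂ) * φ x

/-- `u` is the (global, weak) solution in `C(ℝ; L²(ℝⁿ))` of the Schrödinger equation
`i ∂ₜ u = -Δ u + |x|² u` in `ℝⁿ⁺¹` with initial datum `u(·, 0) = f ∈ L²(ℝⁿ)`: the equation holds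
in the sense of tempered distributions in `x`, i.e. when it is tested against an arbitrary Schwartz
function `φ`, the (formally symmetric) operator `-Δ + |x|²` being moved onto `φ`. -/
structure IsSchrodingerSolution {n : ℕ} (f : L2 n) (u : ℝ → L2 n) : Prop where
  continuous : Continuous u
  initial : u 0 = f
  equation : ∀ (φ : 𝓢(EuclideanSpace ℝ (Fin n), ℂ)) (t : ℝ),
    HasDerivAt (fun s : ℝ => Complex.I * ∫ x, u s x * φ x) (∫ x, u t x * hermiteOp φ x) t

/-- The space-time integral `∫₀^{2π} ∫_{ℝⁿ} |u(x,t)|² / w(x)^δ dx dt ∈ [0, ∞]` for a nonnegative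
function `w`. -/
noncomputable def weightedSpaceTimeIntegral {n : ℕ} (u : ℝ → L2 n)
    (w : EuclideanSpace ℝ (Fin n) → ℝ) (δ : ℝ) : ℝ≥0∞ :=
  ∫⁻ t in Set.Icc (0 : ℝ) (2 * Real.pi), ∫⁻ x, ‖u t x‖ₑ ^ 2 / ENNReal.ofReal (w x ^ δ)

/-!
The harmonic oscillator `H = -Δ + |x|²` is diagonal in the products `h_α(x) = ∏ h_{α_l}(x_l)` of
normalised Hermite functions, with eigenvalues `λ_α = 2 |α| + n`.

*Well-posedness.* The `h_α` are Schwartz functions, orthonormal by the ladder relations, and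
complete: a function `f` orthogonal to all of them has vanishing moments `∫ f P e^{-|x|²/2}`, so
the Fourier transform of `f e^{-|x|²/2}` vanishes (`eq_zero_of_inner_hermiteL2_eq_zero`). The
solution is therefore `∑ e^{-i λ_α t} ⟨h_α, f⟩ h_α`; tested against a Schwartz function `φ` this
series can be differentiated term by term, because `λ_α ⟨h_α, φ⟩` is the coefficient of `H φ` and
hence square summable. Conversely, testing the equation with `h_α` determines the coefficients of
any solution.

*The weighted estimate.* Almost everywhere, `(x_i² + x_j²)^{-δ} ≤ 1 + ρ(x_i) ρ(x_j)` with
`ρ(a) = |a|^{-δ}` on `[-1, 1]` and `ρ = 0` elsewhere (`inv_weight_le`). The term `1` is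
conservation of mass. For the other term, expand the square in the Hermite basis.
Integration over a period in `t` keeps only pairs with `|α| = |β|`, and integration in `x` only
pairs that agree outside the directions `i, j`, since the weight is a product of functions of one
variable. For the remaining resonant pairs the matrix elements are controlled by
`|h_k(y)| ≤ 2 (k + 1)^{-1/4}` for `|y| ≤ 1` (`abs_hermiteFun_le`), which follows from monotonicity
of the energy `h'² + (2k + 1 - y²) h²` away from the origin and the explicit values at `0`. As
`∑_{a + b = k} ((a + 1)(b + 1))^{-1/2} ≤ 4` uniformly in `k` (`sum_one_div_sqrt_mul_le`), Schur's
test (`sum_resonant_le`) bounds the quadratic form by a multiple of `‖f‖²`. Here `δ < 1` is used for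
the integrability of `ρ`. General data are reached by Fatou's lemma. The weight in three variables
is dominated by the weight in two of them.
-/

/-! ### Gaussian functions and polynomial multiples of them -/

lemma one_add_pow_mul_exp_le (m : ℕ) {r : ℝ} (hr : 0 ≤ r) :
    (1 + r) ^ m * Real.exp (-r ^ 2 / 2) ≤ m.factorial * Real.exp (3 / 2) := by
  have h1 : (1 + r) ^ m ≤ m.factorial * Real.exp (1 + r) := by
    have := Real.pow_div_factorial_le_exp (1 + r) (by linarith) m
    rwa [div_le_iff₀ (by positivity), mul_comm] at this
  calc (1 + r) ^ m * Real.exp (-r ^ 2 / 2)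
      ≤ m.factorial * Real.exp (1 + r) * Real.exp (-r ^ 2 / 2) := by gcongr
    _ = m.factorial * Real.exp (1 + r + -r ^ 2 / 2) := by rw [mul_assoc, ← Real.exp_add]
    _ ≤ _ := by
        gcongr
        -- the gap between the exponents is `(r - 1)² / 2`
        nlinarith [sq_nonneg (r - 1)]

/-- The Gaussian `exp (-‖x‖² / 2)` on a real inner product space, as a Schwartz function. -/
noncomputable def schwartzGaussian (E : Type*) [NormedAddCommGroup E] [InnerProductSpace ℝ E] :
    𝓢(E, ℝ) where
  toFun x := Real.exp (-‖x‖ ^ 2 / 2)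
  smooth' := by
    have : ContDiff ℝ (⊤ : ℕ∞) (fun x : E => ‖x‖ ^ 2) := contDiff_norm_sq ℝ
    exact Real.contDiff_exp.comp ((this.neg).div_const 2)
  decay' := by
    intro k n
    have hg : (fun x : E => -‖x‖ ^ 2 / 2).HasTemperateGrowth := by
      have h := (Function.HasTemperateGrowth.const (E := E) (-(1 / 2) : ℝ)).mul
        (Function.hasTemperateGrowth_norm_sq (H := E))
      convert! h using 1
      ext x
      simp only [Pi.mul_apply]
      ring
    obtain ⟨l, C, hC, h⟩ := hg.norm_iteratedFDeriv_le_uniform n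
    refine ⟨n.factorial * (1 + C) ^ n * ((k + l * n).factorial * Real.exp (3 / 2)), fun x => ?_⟩
    have hD : ‖iteratedFDeriv ℝ n (Real.exp ∘ fun x : E => -‖x‖ ^ 2 / 2) x‖ ≤
        n.factorial * Real.exp (-‖x‖ ^ 2 / 2) * ((1 + C) * (1 + ‖x‖) ^ l) ^ n := by
      refine norm_iteratedFDeriv_comp_le (N := n) (Real.contDiff_exp.of_le le_top)
        (hg.1.of_le (by exact_mod_cast le_top)) le_rfl x ?_ ?_
      · intro i _
        rw [norm_iteratedFDeriv_eq_norm_iteratedDeriv, iteratedDeriv_eq_iterate,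
          Real.iter_deriv_exp, Real.norm_eq_abs, abs_of_pos (Real.exp_pos _)]
      · intro i hi hin
        have h1 : 1 ≤ (1 + C) * (1 + ‖x‖) ^ l := by
          have := one_le_pow₀ (n := l) (show 1 ≤ 1 + ‖x‖ by linarith [norm_nonneg x])
          nlinarith
        calc _ ≤ C * (1 + ‖x‖) ^ l := h i hin x
          _ ≤ (1 + C) * (1 + ‖x‖) ^ l := by gcongr; linarith
          _ ≤ _ := le_self_pow₀ h1 (by omega)
    calc ‖x‖ ^ k * ‖iteratedFDeriv ℝ n (Real.exp ∘ fun x : E => -‖x‖ ^ 2 / 2) x‖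
        ≤ (1 + ‖x‖) ^ k *
          (n.factorial * Real.exp (-‖x‖ ^ 2 / 2) * ((1 + C) * (1 + ‖x‖) ^ l) ^ n) := by
          gcongr
          linarith
      _ = n.factorial * (1 + C) ^ n *
          ((1 + ‖x‖) ^ (k + l * n) * Real.exp (-‖x‖ ^ 2 / 2)) := by
          rw [mul_pow, ← pow_mul, pow_add]; ring
      _ ≤ _ := mul_le_mul_of_nonneg_left (one_add_pow_mul_exp_le _ (norm_nonneg x)) (by positivity)

@[simp]
lemma schwartzGaussian_apply {E : Type*} [NormedAddCommGroup E] [InnerProductSpace ℝ E] (x : E) :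
    schwartzGaussian E x = Real.exp (-‖x‖ ^ 2 / 2) := rfl

lemma Polynomial.hasTemperateGrowth_eval_comp {E : Type*} [NormedAddCommGroup E]
    [NormedSpace ℝ E] (p : Polynomial ℝ) {g : E → ℝ} (hg : g.HasTemperateGrowth) :
    (fun x => p.eval (g x)).HasTemperateGrowth := by
  induction p using Polynomial.induction_on' with
  | add p q hp hq =>
    simp only [Polynomial.eval_add]
    exact hp.add hq
  | monomial n a =>
    have h := (Function.HasTemperateGrowth.const (E := E) a).mul (hg.pow n)
    convert! h using 1
    ext x
    simp

/-- The Schwartz function `p(x) exp (-x² / 2)` on the line, for a polynomial `p`. -/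
noncomputable def polyGaussian (p : Polynomial ℝ) : 𝓢(ℝ, ℝ) :=
  smulLeftCLM ℝ (fun x => p.eval x) (schwartzGaussian ℝ)

lemma polyGaussian_apply (p : Polynomial ℝ) (x : ℝ) :
    polyGaussian p x = p.eval x * Real.exp (-x ^ 2 / 2) := by
  rw [polyGaussian, smulLeftCLM_apply_apply
    (p.hasTemperateGrowth_eval_comp Function.HasTemperateGrowth.id')]
  simp

lemma hasDerivAt_polyGaussian (p : Polynomial ℝ) (x : ℝ) :
    HasDerivAt (polyGaussian p) (polyGaussian (p.derivative - Polynomial.X * p) x) x := by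
  have h1 : HasDerivAt (fun x : ℝ => -x ^ 2 / 2) (-x) x := by
    have := ((hasDerivAt_pow 2 x).neg).div_const 2
    convert! this using 1
    norm_num
    ring
  have h := (p.hasDerivAt x).mul h1.exp
  have e : ⇑(polyGaussian p) = (fun x => p.eval x) * fun x => Real.exp (-x ^ 2 / 2) := by
    ext y
    exact polyGaussian_apply p y
  rw [e]
  convert! h using 1
  rw [polyGaussian_apply]
  simp
  ring

/-! ### Hermite functions on the line -/

open Polynomial in
/-- The physicists' Hermite polynomials. -/
noncomputable def physHermite : ℕ → ℝ[X]
  | 0 => 1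
  | k + 1 => 2 * X * physHermite k - derivative (physHermite k)

open Polynomial in
lemma derivative_physHermite_succ (k : ℕ) :
    derivative (physHermite (k + 1)) = (2 * (k + 1) : ℝ) • physHermite k := by
  induction k with
  | zero => simp [physHermite, Polynomial.smul_eq_C_mul]; rfl
  | succ k ih =>
    rw [physHermite, derivative_sub, derivative_mul, ih]
    simp only [derivative_smul]
    rw [show derivative (2 * X : ℝ[X]) = 2 by simp]
    have : physHermite (k + 1) = 2 * X * physHermite k - derivative (physHermite k) := rfl
    rw [this]
    simp only [Polynomial.smul_eq_C_mul]
    have h2 : (C 2 : ℝ[X]) = 2 := rfl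
    simp
    rw [h2]
    ring

lemma degree_physHermite (k : ℕ) : (physHermite k).degree = k := by
  induction k with
  | zero => simp [physHermite]
  | succ k ih =>
    have h2 : (2 * Polynomial.X : Polynomial ℝ) = Polynomial.C 2 * Polynomial.X := rfl
    have h1 : (2 * Polynomial.X * physHermite k : Polynomial ℝ).degree =
        ((k + 1 : ℕ) : WithBot ℕ) := by
      rw [Polynomial.degree_mul, ih, h2, Polynomial.degree_C_mul_X (by norm_num)]
      push_cast
      ring
    rw [physHermite, Polynomial.degree_sub_eq_left_of_degree_lt, h1]
    rw [h1]
    refine lt_of_le_of_lt Polynomial.degree_derivative_le ?_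
    rw [ih]
    exact_mod_cast Nat.lt_succ_self k

/-- The unnormalised Hermite function `H_k(x) exp (-x² / 2)`. -/
noncomputable def hermitePsi (k : ℕ) : 𝓢(ℝ, ℝ) := polyGaussian (physHermite k)

/-- The creation operator: `ψ_k' = x ψ_k - ψ_{k+1}`. -/
lemma hasDerivAt_hermitePsi (k : ℕ) (x : ℝ) :
    HasDerivAt (hermitePsi k) (x * hermitePsi k x - hermitePsi (k + 1) x) x := by
  convert! hasDerivAt_polyGaussian (physHermite k) x using 1
  simp only [hermitePsi, polyGaussian_apply, physHermite]
  simp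
  ring

/-- The annihilation operator: `ψ_{k+1}' = 2 (k + 1) ψ_k - x ψ_{k+1}`. -/
lemma hasDerivAt_hermitePsi_succ (k : ℕ) (x : ℝ) :
    HasDerivAt (hermitePsi (k + 1))
      (2 * (k + 1) * hermitePsi k x - x * hermitePsi (k + 1) x) x := by
  convert! hasDerivAt_polyGaussian (physHermite (k + 1)) x using 1
  simp only [hermitePsi, polyGaussian_apply, derivative_physHermite_succ]
  simp
  ring

/-- The eigenvalue equation `-ψ_k'' + x² ψ_k = (2 k + 1) ψ_k`. -/
lemma hasDerivAt_deriv_hermitePsi (k : ℕ) (x : ℝ) :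
    HasDerivAt (fun y => y * hermitePsi k y - hermitePsi (k + 1) y)
      ((x ^ 2 - (2 * k + 1)) * hermitePsi k x) x := by
  convert! ((hasDerivAt_id' x).mul (hasDerivAt_hermitePsi k x)).sub
    (hasDerivAt_hermitePsi_succ k x) using 1
  ring

lemma integrable_hermitePsi_mul (k m : ℕ) :
    Integrable (fun x => hermitePsi k x * hermitePsi m x) := by
  have := (smulLeftCLM ℝ (hermitePsi k) (hermitePsi m)).integrable (μ := volume)
  rwa [smulLeftCLM_apply (hermitePsi k).hasTemperateGrowth] at this

/-- The creation operator `x - d/dx` is adjoint to the annihilation operator `x + d/dx`. -/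
lemma integral_hermitePsi_succ_mul (k m : ℕ) :
    ∫ x, hermitePsi (k + 1) x * hermitePsi m x =
      ∫ x, hermitePsi k x * (deriv (hermitePsi m) x + x * hermitePsi m x) := by
  have h := integral_mul_deriv_eq_neg_deriv_mul (hermitePsi k) (hermitePsi m)
  have hx : Function.HasTemperateGrowth (fun x : ℝ => x) := Function.HasTemperateGrowth.id'
  have i1 : Integrable fun x => hermitePsi k x * deriv (hermitePsi m) x := by
    have := (smulLeftCLM ℝ (hermitePsi k) (derivCLM ℝ ℝ (hermitePsi m))).integrable (μ := volume)
    rw [smulLeftCLM_apply (hermitePsi k).hasTemperateGrowth] at this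
    simpa using this
  have i3 : Integrable fun x => x * (hermitePsi k x * hermitePsi m x) := by
    have := (smulLeftCLM ℝ (fun x : ℝ => x)
      (smulLeftCLM ℝ (hermitePsi k) (hermitePsi m))).integrable (μ := volume)
    rw [smulLeftCLM_apply hx, smulLeftCLM_apply (hermitePsi k).hasTemperateGrowth] at this
    simpa using this
  have e1 : ∀ x, hermitePsi k x * (deriv (hermitePsi m) x + x * hermitePsi m x) =
    hermitePsi k x * deriv (hermitePsi m) x + x * (hermitePsi k x * hermitePsi m x) :=
    fun x => by ring
  have e2 : ∀ x, deriv (hermitePsi k) x * hermitePsi m x = x * (hermitePsi k x * hermitePsi m x)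
      - hermitePsi (k + 1) x * hermitePsi m x := fun x => by
    rw [(hasDerivAt_hermitePsi k x).deriv]; ring
  simp_rw [e1]
  simp_rw [e2] at h
  rw [integral_add i1 i3, h, integral_sub i3 (integrable_hermitePsi_mul _ _)]
  ring

lemma integral_hermitePsi_succ_mul_zero (k : ℕ) :
    ∫ x, hermitePsi (k + 1) x * hermitePsi 0 x = 0 := by
  rw [integral_hermitePsi_succ_mul]
  have : ∀ x, deriv (hermitePsi 0) x + x * hermitePsi 0 x = 0 := fun x => by
    rw [(hasDerivAt_hermitePsi 0 x).deriv]
    simp [hermitePsi, polyGaussian_apply, physHermite]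
    ring
  simp [this]

lemma integral_hermitePsi_succ_mul_succ (k m : ℕ) :
    ∫ x, hermitePsi (k + 1) x * hermitePsi (m + 1) x =
      2 * (m + 1) * ∫ x, hermitePsi k x * hermitePsi m x := by
  rw [integral_hermitePsi_succ_mul, ← integral_const_mul]
  congr 1
  ext x
  rw [(hasDerivAt_hermitePsi_succ m x).deriv]
  ring

/-- The squared `L²` norm of `ψ_k`. -/
noncomputable def hermiteNormSq (k : ℕ) : ℝ := 2 ^ k * k.factorial * √Real.pi

lemma hermiteNormSq_pos (k : ℕ) : 0 < hermiteNormSq k := by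
  unfold hermiteNormSq
  have := Real.pi_pos
  positivity

lemma integral_hermitePsi_mul (k m : ℕ) :
    ∫ x, hermitePsi k x * hermitePsi m x = if k = m then hermiteNormSq k else 0 := by
  induction k generalizing m with
  | zero =>
    cases m with
    | zero =>
      have := integral_gaussian 1
      simp only [hermitePsi, polyGaussian_apply, physHermite, hermiteNormSq]
      simp only [Polynomial.eval_one, one_mul, ← Real.exp_add]
      rw [div_one] at this
      simp only [pow_zero, Nat.factorial_zero, Nat.cast_one, one_mul, if_true]
      rw [← this]
      congr 1
      ext x
      ring_nf
    | succ m =>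
      simp_rw [mul_comm (hermitePsi 0 _)]
      rw [integral_hermitePsi_succ_mul_zero]
      simp
  | succ k ih =>
    cases m with
    | zero => rw [integral_hermitePsi_succ_mul_zero]; simp
    | succ m =>
      rw [integral_hermitePsi_succ_mul_succ, ih]
      by_cases h : k = m
      · subst h
        simp only [hermiteNormSq, if_true, Nat.factorial_succ, pow_succ]
        push_cast
        ring
      · simp [h]

/-! ### Pointwise bounds near the origin -/

lemma physHermite_eval_zero_succ_succ (k : ℕ) :
    (physHermite (k + 2)).eval 0 = -(2 * (k + 1)) * (physHermite k).eval 0 := by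
  rw [physHermite, derivative_physHermite_succ]
  simp

/-- In terms of `b_k = H_k(0)² / (2^k k!)` this says `b_k ≤ (k + 1) ^ (-1/2)`; it follows from
`b_{k+2} = (k + 1) / (k + 2) b_k`, because `(k + 1)² (k + 3) ≤ (k + 2)² (k + 1)`. -/
lemma physHermite_eval_zero_sq_le (k : ℕ) :
    ((physHermite k).eval 0) ^ 2 * √(k + 1) ≤ 2 ^ k * k.factorial := by
  induction k using Nat.twoStepInduction with
  | zero => simp [physHermite]
  | one => simp [physHermite]
  | more k ih _ =>
    have hs : (k + 1 : ℝ) * √(k + 2 + 1) ≤ (k + 2) * √(k + 1) := by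
      rw [← Real.sqrt_sq (show (0 : ℝ) ≤ k + 1 by positivity), ← Real.sqrt_mul (by positivity),
        ← Real.sqrt_sq (show (0 : ℝ) ≤ k + 2 by positivity), ← Real.sqrt_mul (by positivity)]
      rw [Real.sqrt_sq (by positivity), Real.sqrt_sq (by positivity)]
      apply Real.sqrt_le_sqrt
      have : (0 : ℝ) ≤ k := k.cast_nonneg
      nlinarith
    rw [physHermite_eval_zero_succ_succ, Nat.factorial_succ, Nat.factorial_succ, pow_add]
    push_cast
    calc (-(2 * ((k : ℝ) + 1)) * (physHermite k).eval 0) ^ 2 * √(k + 2 + 1)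
        = 4 * (k + 1) * ((physHermite k).eval 0) ^ 2 * ((k + 1) * √(k + 2 + 1)) := by ring
      _ ≤ 4 * (k + 1) * ((physHermite k).eval 0) ^ 2 * ((k + 2) * √(k + 1)) := by gcongr
      _ = 4 * (k + 1) * (k + 2) * (((physHermite k).eval 0) ^ 2 * √(k + 1)) := by ring
      _ ≤ 4 * (k + 1) * (k + 2) * (2 ^ k * k.factorial) := by gcongr
      _ = _ := by ring

/-- The energy `ψ'² + (2 k + 1 - x²) ψ²` of the eigenvalue equation. -/
noncomputable def hermiteEnergy (k : ℕ) (x : ℝ) : ℝ :=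
  (x * hermitePsi k x - hermitePsi (k + 1) x) ^ 2 + (2 * k + 1 - x ^ 2) * hermitePsi k x ^ 2

lemma hasDerivAt_hermiteEnergy (k : ℕ) (x : ℝ) :
    HasDerivAt (hermiteEnergy k) (-2 * x * hermitePsi k x ^ 2) x := by
  have h1 := (hasDerivAt_deriv_hermitePsi k x).pow 2
  have h2 := (hasDerivAt_hermitePsi k x).pow 2
  have h3 : HasDerivAt (fun x : ℝ => (2 * k + 1 - x ^ 2 : ℝ)) (-(2 * x)) x := by
    simpa using ((hasDerivAt_pow 2 x).const_sub (2 * k + 1 : ℝ))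
  convert! h1.add (h3.mul h2) using 1
  simp
  ring

lemma hermiteEnergy_le (k : ℕ) (x : ℝ) : hermiteEnergy k x ≤ hermiteEnergy k 0 := by
  have hd : Differentiable ℝ (hermiteEnergy k) :=
    fun y => (hasDerivAt_hermiteEnergy k y).differentiableAt
  rcases le_total 0 x with hx | hx
  · refine antitoneOn_of_deriv_nonpos (convex_Ici 0) hd.continuous.continuousOn
      hd.differentiableOn (fun y hy => ?_) (Set.mem_Ici.2 le_rfl) hx hx
    rw [interior_Ici, Set.mem_Ioi] at hy
    rw [(hasDerivAt_hermiteEnergy k y).deriv]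
    nlinarith [mul_nonneg hy.le (sq_nonneg (hermitePsi k y))]
  · refine monotoneOn_of_deriv_nonneg (convex_Iic 0) hd.continuous.continuousOn
      hd.differentiableOn (fun y hy => ?_) hx (Set.mem_Iic.2 le_rfl) hx
    rw [interior_Iic, Set.mem_Iio] at hy
    rw [(hasDerivAt_hermiteEnergy k y).deriv]
    nlinarith [mul_nonneg (neg_nonneg.2 hy.le) (sq_nonneg (hermitePsi k y))]

lemma hermitePsi_zero_arg (k : ℕ) : hermitePsi k 0 = (physHermite k).eval 0 := by
  simp [hermitePsi, polyGaussian_apply]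

lemma hermiteEnergy_zero_mul_le (k : ℕ) :
    hermiteEnergy k 0 * √(k + 1) ≤ 4 * (k + 1) * (2 ^ k * k.factorial) := by
  have h1 := physHermite_eval_zero_sq_le k
  have h2 := physHermite_eval_zero_sq_le (k + 1)
  have h3 : √((k : ℝ) + 1) ≤ √((k + 1 : ℕ) + 1) := Real.sqrt_le_sqrt (by push_cast; linarith)
  have h4 : ((physHermite (k + 1)).eval 0) ^ 2 * √(k + 1) ≤ 2 * (k + 1) * (2 ^ k * k.factorial) :=
    calc _ ≤ ((physHermite (k + 1)).eval 0) ^ 2 * √((k + 1 : ℕ) + 1) := by gcongr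
      _ ≤ _ := h2
      _ = _ := by rw [Nat.factorial_succ, pow_succ]; push_cast; ring
  have h5 := mul_le_mul_of_nonneg_left h1 (show (0 : ℝ) ≤ 2 * k + 1 by positivity)
  have h6 : (0 : ℝ) ≤ 2 ^ k * k.factorial := by positivity
  simp only [hermiteEnergy, hermitePsi_zero_arg]
  nlinarith

lemma hermitePsi_sq_mul_le (k : ℕ) {x : ℝ} (hx : |x| ≤ 1) :
    hermitePsi k x ^ 2 * √(k + 1) ≤ 4 * (2 ^ k * k.factorial) := by
  have hx2 : x ^ 2 ≤ 1 := by rwa [sq_le_one_iff_abs_le_one]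
  -- for `k = 0` the coefficient `2 k + 1 - x²` of the energy degenerates at `|x| = 1`
  rcases Nat.eq_zero_or_pos k with rfl | hk
  · simp only [hermitePsi, polyGaussian_apply, physHermite]
    simp
    have : Real.exp (-x ^ 2 / 2) ≤ 1 := Real.exp_le_one_iff.2 (by nlinarith [sq_nonneg x])
    nlinarith [Real.exp_pos (-x ^ 2 / 2)]
  · have h1 := hermiteEnergy_le k x
    have h2 := hermiteEnergy_zero_mul_le k
    have hk' : (1 : ℝ) ≤ k := by exact_mod_cast hk
    have h3 : (k + 1) * hermitePsi k x ^ 2 ≤ hermiteEnergy k x := by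
      unfold hermiteEnergy
      have : (k + 1) * hermitePsi k x ^ 2 ≤ (2 * k + 1 - x ^ 2) * hermitePsi k x ^ 2 := by
        gcongr
        linarith
      nlinarith [sq_nonneg (x * hermitePsi k x - hermitePsi (k + 1) x)]
    have h4 : (k + 1) * (hermitePsi k x ^ 2 * √(k + 1)) ≤
        (k + 1) * (4 * (2 ^ k * k.factorial)) := by
      calc _ = (k + 1) * hermitePsi k x ^ 2 * √(k + 1) := by ring
        _ ≤ hermiteEnergy k 0 * √(k + 1) := by gcongr; exact h3.trans h1
        _ ≤ _ := h2
        _ = _ := by ring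
    exact le_of_mul_le_mul_left h4 (by positivity)

/-- The `L²`-normalised Hermite function on the line. -/
noncomputable def hermiteFun (k : ℕ) (x : ℝ) : ℝ := hermitePsi k x / √(hermiteNormSq k)

lemma continuous_hermiteFun (k : ℕ) : Continuous (hermiteFun k) :=
  (hermitePsi k).continuous.div_const _

lemma integrable_hermiteFun_mul (k m : ℕ) :
    Integrable (fun x => hermiteFun k x * hermiteFun m x) := by
  convert! (integrable_hermitePsi_mul k m).div_const (√(hermiteNormSq k) * √(hermiteNormSq m))
    using 2 with x
  simp only [hermiteFun]
  ring

lemma integral_hermiteFun_mul (k m : ℕ) :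
    ∫ x, hermiteFun k x * hermiteFun m x = if k = m then 1 else 0 := by
  have : ∀ x, hermiteFun k x * hermiteFun m x =
    hermitePsi k x * hermitePsi m x / (√(hermiteNormSq k) * √(hermiteNormSq m)) := fun x => by
    simp only [hermiteFun]
    ring
  simp_rw [this]
  rw [integral_div, integral_hermitePsi_mul]
  by_cases h : k = m
  · subst h
    have := hermiteNormSq_pos k
    rw [if_pos rfl, if_pos rfl, Real.mul_self_sqrt this.le, div_self this.ne']
  · simp [h]

/-- The weight `(k + 1) ^ (-1/4)` governing the size of the `k`-th Hermite function near `0`. -/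
noncomputable def hermiteDecay (k : ℕ) : ℝ := √(1 / √(k + 1))

lemma hermiteDecay_nonneg (k : ℕ) : 0 ≤ hermiteDecay k := Real.sqrt_nonneg _

lemma hermiteDecay_sq (k : ℕ) : hermiteDecay k ^ 2 = 1 / √(k + 1) :=
  Real.sq_sqrt (by positivity)

/-- On `[-1, 1]` the `k`-th normalised Hermite function is `O((k + 1) ^ (-1/4))`. -/
lemma abs_hermiteFun_le (k : ℕ) {x : ℝ} (hx : |x| ≤ 1) :
    |hermiteFun k x| ≤ 2 * hermiteDecay k := by
  apply abs_le_of_sq_le_sq _ (by have := hermiteDecay_nonneg k; positivity)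
  have h := hermitePsi_sq_mul_le k hx
  have hpi : 1 ≤ √Real.pi := Real.one_le_sqrt.2 (by linarith [Real.pi_gt_three])
  rw [mul_pow, hermiteDecay_sq, hermiteFun, div_pow, Real.sq_sqrt (hermiteNormSq_pos k).le,
    div_le_iff₀ (hermiteNormSq_pos k), hermiteNormSq]
  have hs : 0 < √((k : ℝ) + 1) := Real.sqrt_pos.2 (by positivity)
  have h6 : (0 : ℝ) ≤ 2 ^ k * k.factorial := by positivity
  have : hermitePsi k x ^ 2 ≤ 4 * (2 ^ k * k.factorial) / √(k + 1) := by
    rwa [le_div_iff₀ hs]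
  refine this.trans ?_
  calc 4 * (2 ^ k * k.factorial : ℝ) / √(k + 1) =
      2 ^ 2 * (1 / √(k + 1)) * (2 ^ k * k.factorial * 1) := by ring
    _ ≤ _ := by gcongr

/-! ### Hermite functions in `n` variables -/

section Product

variable {n : ℕ}

lemma integrable_euclidean_prod {F : Fin n → ℝ → ℝ} (hF : ∀ l, Integrable (F l)) :
    Integrable (fun x : EuclideanSpace ℝ (Fin n) => ∏ l, F l (x l)) := by
  rw [← (PiLp.volume_preserving_toLp (Fin n)).integrable_comp_emb
    (MeasurableEquiv.toLp 2 _).measurableEmbedding]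
  exact Integrable.fintype_prod hF

lemma integral_euclidean_prod (F : Fin n → ℝ → ℝ) :
    ∫ x : EuclideanSpace ℝ (Fin n), ∏ l, F l (x l) = ∏ l, ∫ y, F l y := by
  rw [← (PiLp.volume_preserving_toLp (Fin n)).integral_comp
    (MeasurableEquiv.toLp 2 _).measurableEmbedding]
  exact integral_fintype_prod_volume_eq_prod F

/-- Directional derivative along the `l`-th axis of a product of functions of one variable. -/
lemma hasLineDerivAt_mul_prod_erase (F : Fin n → ℝ → ℝ) (l : Fin n) {g : ℝ → ℝ} {g' : ℝ}
    (x : EuclideanSpace ℝ (Fin n)) (hg : HasDerivAt g g' (x l)) :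
    HasLineDerivAt ℝ
      (fun y : EuclideanSpace ℝ (Fin n) =>
        ((g (y l) * ∏ m ∈ Finset.univ.erase l, F m (y m) : ℝ) : ℂ))
      ((g' * ∏ m ∈ Finset.univ.erase l, F m (x m) : ℝ) : ℂ) x
      (EuclideanSpace.basisFun (Fin n) ℝ l) := by
  rw [HasLineDerivAt]
  have e : (fun t : ℝ => ((g ((x + t • EuclideanSpace.basisFun (Fin n) ℝ l) l) *
      ∏ m ∈ Finset.univ.erase l,
        F m ((x + t • EuclideanSpace.basisFun (Fin n) ℝ l) m) : ℝ) : ℂ)) =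
      fun t : ℝ => ((g (x l + t) * ∏ m ∈ Finset.univ.erase l, F m (x m) : ℝ) : ℂ) := by
    ext t
    congr 2
    · simp
    · refine Finset.prod_congr rfl fun m hm => ?_
      simp [(Finset.mem_erase.1 hm).1]
  rw [e]
  have h1 : HasDerivAt (fun t : ℝ => g (x l + t)) g' 0 := by
    have : HasDerivAt g g' (x l + 0) := by rwa [add_zero]
    exact this.comp_const_add (x l) 0
  exact (h1.mul_const _).ofReal_comp

end Product

/-- The product `∏ h_{α_l}(x_l)` of normalised Hermite functions. -/
noncomputable def hermiteProd {n : ℕ} (α : Fin n → ℕ) (x : EuclideanSpace ℝ (Fin n)) : ℝ :=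
  ∏ l, hermiteFun (α l) (x l)

lemma continuous_hermiteProd {n : ℕ} (α : Fin n → ℕ) : Continuous (hermiteProd α) :=
  continuous_finsetProd _ fun l _ =>
    (continuous_hermiteFun (α l)).comp (EuclideanSpace.proj l).continuous

lemma schwartzGaussian_euclidean {n : ℕ} (x : EuclideanSpace ℝ (Fin n)) :
    schwartzGaussian (EuclideanSpace ℝ (Fin n)) x = ∏ l, Real.exp (-x l ^ 2 / 2) := by
  rw [schwartzGaussian_apply, EuclideanSpace.norm_sq_eq, ← Real.exp_sum, ← Finset.sum_div,
    Finset.sum_neg_distrib]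
  simp

lemma MvPolynomial.hasTemperateGrowth_eval {n : ℕ} (P : MvPolynomial (Fin n) ℝ) :
    (fun x : EuclideanSpace ℝ (Fin n) => MvPolynomial.eval x P).HasTemperateGrowth := by
  induction P using MvPolynomial.induction_on with
  | C a => simp
  | add p q hp hq =>
    simp only [map_add]
    exact hp.add hq
  | mul_X p l hp =>
    simp only [map_mul, MvPolynomial.eval_X]
    exact hp.mul (EuclideanSpace.proj l : EuclideanSpace ℝ (Fin n) →L[ℝ] ℝ).hasTemperateGrowth

/-- The complex-valued Schwartz function `P(x) exp (-‖x‖² / 2)`, for a polynomial `P`. -/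
noncomputable def mvPolyGaussian {n : ℕ} (P : MvPolynomial (Fin n) ℝ) :
    𝓢(EuclideanSpace ℝ (Fin n), ℂ) :=
  postcompCLM Complex.ofRealCLM (smulLeftCLM ℝ
    (fun x : EuclideanSpace ℝ (Fin n) => MvPolynomial.eval x P) (schwartzGaussian _))

lemma mvPolyGaussian_apply {n : ℕ} (P : MvPolynomial (Fin n) ℝ) (x : EuclideanSpace ℝ (Fin n)) :
    mvPolyGaussian P x =
      ((MvPolynomial.eval x P * schwartzGaussian (EuclideanSpace ℝ (Fin n)) x : ℝ) : ℂ) := by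
  rw [mvPolyGaussian, postcompCLM_apply, smulLeftCLM_apply_apply P.hasTemperateGrowth_eval]
  rfl

/-- The product of Hermite polynomials `∏ H_{α_l}(X_l)`. -/
noncomputable def mvHermite {n : ℕ} (α : Fin n → ℕ) : MvPolynomial (Fin n) ℝ :=
  ∏ l, Polynomial.aeval (MvPolynomial.X l) (physHermite (α l))

lemma eval_aeval_X {n : ℕ} (p : Polynomial ℝ) (l : Fin n) (x : Fin n → ℝ) :
    MvPolynomial.eval x (Polynomial.aeval (MvPolynomial.X l) p) = p.eval (x l) := by
  have := Polynomial.aeval_algHom_apply (MvPolynomial.aeval (R := ℝ) x) (MvPolynomial.X l) p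
  simpa using this.symm

lemma mvPolyGaussian_mvHermite_apply {n : ℕ} (α : Fin n → ℕ) (x : EuclideanSpace ℝ (Fin n)) :
    mvPolyGaussian (mvHermite α) x =
      (((∏ l, √(hermiteNormSq (α l))) * hermiteProd α x : ℝ) : ℂ) := by
  rw [mvPolyGaussian_apply, schwartzGaussian_euclidean, mvHermite, map_prod, hermiteProd,
    ← Finset.prod_mul_distrib, ← Finset.prod_mul_distrib]
  congr 1
  refine Finset.prod_congr rfl fun l _ => ?_
  have h := (Real.sqrt_pos.2 (hermiteNormSq_pos (α l))).ne'
  rw [eval_aeval_X, hermiteFun, mul_div_cancel₀ _ h, hermitePsi, polyGaussian_apply]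

/-- The `n`-dimensional normalised Hermite function as a complex-valued Schwartz function. -/
noncomputable def hermiteSchwartz {n : ℕ} (α : Fin n → ℕ) : 𝓢(EuclideanSpace ℝ (Fin n), ℂ) :=
  ((∏ l, √(hermiteNormSq (α l)))⁻¹ : ℝ) • mvPolyGaussian (mvHermite α)

lemma prod_sqrt_hermiteNormSq_pos {n : ℕ} (α : Fin n → ℕ) :
    0 < ∏ l, √(hermiteNormSq (α l)) :=
  Finset.prod_pos fun l _ => Real.sqrt_pos.2 (hermiteNormSq_pos (α l))

@[simp]
lemma hermiteSchwartz_apply {n : ℕ} (α : Fin n → ℕ) (x : EuclideanSpace ℝ (Fin n)) :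
    hermiteSchwartz α x = hermiteProd α x := by
  rw [hermiteSchwartz, smul_apply, mvPolyGaussian_mvHermite_apply, Complex.real_smul,
    ← Complex.ofReal_mul, inv_mul_cancel_left₀ (prod_sqrt_hermiteNormSq_pos α).ne']

/-- The eigenvalue `2 |α| + n` of the harmonic oscillator. -/
def hermiteEigenvalue {n : ℕ} (α : Fin n → ℕ) : ℝ := ∑ l, (2 * (α l : ℝ) + 1)

lemma hasDerivAt_hermiteFun (k : ℕ) (x : ℝ) :
    HasDerivAt (hermiteFun k)
      ((x * hermitePsi k x - hermitePsi (k + 1) x) / √(hermiteNormSq k)) x :=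
  (hasDerivAt_hermitePsi k x).div_const _

lemma hasDerivAt_deriv_hermiteFun (k : ℕ) (x : ℝ) :
    HasDerivAt (fun y => (y * hermitePsi k y - hermitePsi (k + 1) y) / √(hermiteNormSq k))
      ((x ^ 2 - (2 * k + 1)) * hermiteFun k x) x := by
  convert! (hasDerivAt_deriv_hermitePsi k x).div_const (√(hermiteNormSq k)) using 1
  rw [hermiteFun]
  ring

open LineDeriv in
lemma lineDeriv_lineDeriv_hermiteSchwartz {n : ℕ} (α : Fin n → ℕ) (l : Fin n)
    (x : EuclideanSpace ℝ (Fin n)) :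
    (∂_{EuclideanSpace.basisFun (Fin n) ℝ l} (∂_{EuclideanSpace.basisFun (Fin n) ℝ l}
      (hermiteSchwartz α)) : 𝓢(EuclideanSpace ℝ (Fin n), ℂ)) x =
      (((x l) ^ 2 - (2 * α l + 1) : ℝ) : ℂ) * hermiteSchwartz α x := by
  have e0 : ⇑(hermiteSchwartz α) = fun y : EuclideanSpace ℝ (Fin n) =>
      ((hermiteFun (α l) (y l) *
        ∏ m ∈ Finset.univ.erase l, hermiteFun (α m) (y m) : ℝ) : ℂ) := by
    ext y
    rw [hermiteSchwartz_apply, hermiteProd,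
      Finset.mul_prod_erase _ (fun m => hermiteFun (α m) (y m)) (Finset.mem_univ l)]
  have e1 : ⇑(∂_{EuclideanSpace.basisFun (Fin n) ℝ l} (hermiteSchwartz α) :
      𝓢(EuclideanSpace ℝ (Fin n), ℂ)) =
      fun y : EuclideanSpace ℝ (Fin n) =>
      (((fun z => (z * hermitePsi (α l) z - hermitePsi (α l + 1) z) /
          √(hermiteNormSq (α l))) (y l) *
        ∏ m ∈ Finset.univ.erase l, hermiteFun (α m) (y m) : ℝ) : ℂ) := by
    ext y
    rw [lineDerivOp_apply, e0]
    exact (hasLineDerivAt_mul_prod_erase (fun m => hermiteFun (α m)) l y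
      (hasDerivAt_hermiteFun (α l) (y l))).lineDeriv
  rw [lineDerivOp_apply, e1, (hasLineDerivAt_mul_prod_erase (fun m => hermiteFun (α m)) l x
      (hasDerivAt_deriv_hermiteFun (α l) (x l))).lineDeriv, e0]
  push_cast
  ring

lemma hermiteOp_hermiteSchwartz {n : ℕ} (α : Fin n → ℕ) (x : EuclideanSpace ℝ (Fin n)) :
    hermiteOp (hermiteSchwartz α) x = hermiteEigenvalue α * hermiteSchwartz α x := by
  rw [hermiteOp, laplacian_eq_sum (EuclideanSpace.basisFun (Fin n) ℝ), sum_apply]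
  simp_rw [lineDeriv_lineDeriv_hermiteSchwartz]
  rw [← Finset.sum_mul, EuclideanSpace.norm_sq_eq, hermiteEigenvalue]
  push_cast
  rw [Finset.sum_sub_distrib]
  simp only [Real.norm_eq_abs]
  rw [show ∑ l, ((|x l| : ℝ) : ℂ) ^ 2 = ∑ l, ((x l : ℝ) : ℂ) ^ 2 from
    Finset.sum_congr rfl fun l _ => by rw [← Complex.ofReal_pow, sq_abs, Complex.ofReal_pow]]
  ring

lemma integral_hermiteProd_mul {n : ℕ} (α β : Fin n → ℕ) :
    ∫ x, hermiteProd α x * hermiteProd β x = if α = β then 1 else 0 := by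
  simp_rw [hermiteProd, ← Finset.prod_mul_distrib]
  rw [integral_euclidean_prod (fun l y => hermiteFun (α l) y * hermiteFun (β l) y)]
  simp_rw [integral_hermiteFun_mul]
  by_cases h : α = β
  · simp [h]
  · rw [if_neg h]
    obtain ⟨l, hl⟩ := Function.ne_iff.1 h
    exact Finset.prod_eq_zero (Finset.mem_univ l) (if_neg hl)

/-- The Hermite functions as elements of `L²`. -/
noncomputable def hermiteL2 {n : ℕ} (α : Fin n → ℕ) : L2 n := (hermiteSchwartz α).toLp 2 volume

lemma coeFn_hermiteL2 {n : ℕ} (α : Fin n → ℕ) :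
    hermiteL2 α =ᵐ[volume] fun x => (hermiteProd α x : ℂ) := by
  filter_upwards [(hermiteSchwartz α).coeFn_toLp 2 volume] with x hx
  rw [hermiteL2, hx, hermiteSchwartz_apply]

lemma inner_hermiteL2_left {n : ℕ} (α : Fin n → ℕ) (f : L2 n) :
    inner ℂ (hermiteL2 α) f = ∫ x, f x * hermiteSchwartz α x := by
  rw [L2.inner_def]
  refine integral_congr_ae ?_
  filter_upwards [coeFn_hermiteL2 α] with x hx
  simp [hx]

lemma orthonormal_hermiteL2 (n : ℕ) :
    Orthonormal ℂ (hermiteL2 : (Fin n → ℕ) → L2 n) := by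
  rw [orthonormal_iff_ite]
  intro α β
  rw [inner_hermiteL2_left]
  have : ∫ x, (hermiteL2 β x : ℂ) * hermiteSchwartz α x =
      ∫ x, ((hermiteProd α x * hermiteProd β x : ℝ) : ℂ) := by
    refine integral_congr_ae ?_
    filter_upwards [coeFn_hermiteL2 β] with x hx
    rw [hx]
    simp [mul_comm]
  rw [this, integral_complex_ofReal, integral_hermiteProd_mul]
  split_ifs <;> simp

/-! ### Completeness of the Hermite functions -/

lemma integrable_schwartz_mul_L2 {n : ℕ} (φ : 𝓢(EuclideanSpace ℝ (Fin n), ℂ)) (f : L2 n) :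
    Integrable (fun x => f x * φ x) :=
  (Lp.memLp f).integrable_mul (φ.memLp 2 volume)

/-- The moment `∫ f P exp (-‖x‖² / 2)` as a linear functional of the polynomial `P`. -/
noncomputable def gaussianMoment {n : ℕ} (f : L2 n) : MvPolynomial (Fin n) ℝ →ₗ[ℝ] ℂ where
  toFun P := ∫ x, f x * mvPolyGaussian P x
  map_add' P Q := by
    rw [← integral_add (integrable_schwartz_mul_L2 _ _) (integrable_schwartz_mul_L2 _ _)]
    refine integral_congr_ae (.of_forall fun x => ?_)
    simp only [mvPolyGaussian_apply, map_add]
    push_cast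
    ring
  map_smul' c P := by
    rw [RingHom.id_apply, ← integral_smul]
    refine integral_congr_ae (.of_forall fun x => ?_)
    simp only [mvPolyGaussian_apply, MvPolynomial.smul_eval, Complex.real_smul]
    push_cast
    ring

/-- The Hermite polynomials as a sequence of polynomials with one member in each degree. -/
noncomputable def physHermiteSequence : Polynomial.Sequence ℝ where
  elems' := physHermite
  degree_eq' := degree_physHermite

/-- Products of Hermite polynomials in separate variables span all polynomials. -/
lemma gaussianMoment_eq_zero {n : ℕ} {f : L2 n} (hf : ∀ α, inner ℂ (hermiteL2 α) f = 0) :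
    gaussianMoment f = 0 := by
  have h0 : ∀ α, gaussianMoment f (mvHermite α) = 0 := by
    intro α
    have h := hf α
    rw [inner_hermiteL2_left] at h
    have e : ∀ x, f x * mvPolyGaussian (mvHermite α) x =
        ((∏ l, √(hermiteNormSq (α l)) : ℝ) : ℂ) * (f x * hermiteSchwartz α x) := fun x => by
      rw [mvPolyGaussian_mvHermite_apply, hermiteSchwartz_apply]
      push_cast
      ring
    change ∫ x, f x * mvPolyGaussian (mvHermite α) x = 0
    simp_rw [e]
    rw [integral_const_mul, h, mul_zero]
  -- a product of polynomials in separate variables depends multilinearly on its factors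
  let M : MultilinearMap ℝ (fun _ : Fin n => Polynomial ℝ) ℂ :=
    (gaussianMoment f).compMultilinearMap
      ((MultilinearMap.mkPiAlgebra ℝ (Fin n) (MvPolynomial (Fin n) ℝ)).compLinearMap
        fun l => (Polynomial.aeval (MvPolynomial.X l)).toLinearMap)
  have hM : ∀ p, M p = gaussianMoment f (∏ l, Polynomial.aeval (MvPolynomial.X l) (p l)) := by
    intro p
    simp [M]
  have hlead : ∀ i, IsUnit (physHermiteSequence i).leadingCoeff := fun i =>
    (Polynomial.leadingCoeff_ne_zero.2 (physHermiteSequence.ne_zero i)).isUnit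
  have hM0 : M = 0 := by
    refine Module.Basis.ext_multilinear (fun _ => physHermiteSequence.basis hlead) fun v => ?_
    simp only [Polynomial.Sequence.basis_eq_self]
    rw [hM]
    exact h0 v
  refine MvPolynomial.linearMap_ext fun s => LinearMap.ext_ring ?_
  have h := hM (fun l => Polynomial.X ^ s l)
  rw [hM0] at h
  simp only [map_pow, Polynomial.aeval_X, zero_apply] at h
  simp only [LinearMap.comp_apply, LinearMap.zero_apply]
  rw [h, MvPolynomial.monomial_eq, Finsupp.prod_fintype _ _ (fun _ => pow_zero _)]
  simp

/-- Completing the square, the function is a multiple of a translate of the Gaussian. -/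
lemma memLp_exp_inner_mul_gaussian {n : ℕ} (v : EuclideanSpace ℝ (Fin n)) :
    MemLp (fun x => Real.exp (inner ℝ v x) * schwartzGaussian (EuclideanSpace ℝ (Fin n)) x) 2 := by
  have h := ((schwartzGaussian (EuclideanSpace ℝ (Fin n))).memLp 2 volume).comp_measurePreserving
    (measurePreserving_sub_right volume v)
  refine (h.const_mul (Real.exp (‖v‖ ^ 2 / 2))).ae_eq (.of_forall fun x => ?_)
  simp only [Function.comp_apply, schwartzGaussian_apply, ← Real.exp_add]
  congr 1
  rw [norm_sub_sq_real, real_inner_comm]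
  ring

/-- Expanding the exponential series, the vanishing of all moments of `f exp (-‖x‖² / 2)` gives the
vanishing of its Fourier transform. -/
lemma integral_exp_mul_gaussian_eq_zero {n : ℕ} {f : L2 n} (hf : gaussianMoment f = 0)
    (v : EuclideanSpace ℝ (Fin n)) :
    ∫ x, Complex.exp ((inner ℝ v x : ℝ) * Complex.I) *
      (f x * schwartzGaussian (EuclideanSpace ℝ (Fin n)) x) = 0 := by
  set w := schwartzGaussian (EuclideanSpace ℝ (Fin n)) with hw
  have hw0 : ∀ x, 0 ≤ w x := fun x => (Real.exp_pos _).le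
  let P : MvPolynomial (Fin n) ℝ := ∑ l, MvPolynomial.C (v l) * MvPolynomial.X l
  have hP : ∀ x : EuclideanSpace ℝ (Fin n), MvPolynomial.eval x P = inner ℝ v x := by
    intro x
    simp [P, PiLp.inner_apply, mul_comm]
  let F : ℕ → EuclideanSpace ℝ (Fin n) → ℂ := fun k x =>
    ((inner ℝ v x : ℝ) * Complex.I) ^ k / k.factorial * (f x * w x)
  have hF : ∀ k, F k = fun x =>
      (Complex.I ^ k / k.factorial) * (f x * mvPolyGaussian (P ^ k) x) := by
    intro k
    ext x
    simp only [F, mvPolyGaussian_apply, map_pow, hP, ← hw]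
    push_cast
    ring
  have h0 : ∀ k, ∫ x, F k x = 0 := by
    intro k
    rw [hF, integral_const_mul]
    have : ∫ x, f x * mvPolyGaussian (P ^ k) x = 0 := LinearMap.congr_fun hf (P ^ k)
    rw [this, mul_zero]
  have hs : ∀ x, HasSum (fun k : ℕ => |inner ℝ v x| ^ k / k.factorial * (‖f x‖ * w x))
      (Real.exp |inner ℝ v x| * (‖f x‖ * w x)) := fun x => by
    refine HasSum.mul_right _ ?_
    rw [Real.exp_eq_exp_ℝ]
    exact NormedSpace.expSeries_div_hasSum_exp _
  have key := hasSum_integral_of_dominated_convergence (μ := volume) (F := F)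
    (f := fun x => Complex.exp ((inner ℝ v x : ℝ) * Complex.I) * (f x * w x))
    (fun k x => |inner ℝ v x| ^ k / k.factorial * (‖f x‖ * w x))
    (fun k => by
      rw [hF]
      exact ((integrable_schwartz_mul_L2 _ f).const_mul _).1)
    (fun k => .of_forall fun x => by
      simp only [F, norm_mul, norm_div, norm_pow, Complex.norm_I, Complex.norm_real, mul_one,
        Real.norm_eq_abs, abs_of_nonneg (hw0 x)]
      simp)
    (.of_forall fun x => (hs x).summable)
    (by
      simp_rw [fun x => (hs x).tsum_eq]
      -- `exp |y| ≤ exp y + exp (-y)`, and each exponential is absorbed by the Gaussian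
      have i1 := (Lp.memLp f).norm.integrable_mul (memLp_exp_inner_mul_gaussian v)
      have i2 := (Lp.memLp f).norm.integrable_mul (memLp_exp_inner_mul_gaussian (-v))
      refine (i1.add i2).mono' ?_ (.of_forall fun x => ?_)
      · refine AEStronglyMeasurable.mul ?_ ((Lp.aestronglyMeasurable f).norm.mul
          w.continuous.aestronglyMeasurable)
        exact (by fun_prop : Continuous fun x => Real.exp |inner ℝ v x|).aestronglyMeasurable
      · have h1 : Real.exp |inner ℝ v x| ≤ Real.exp (inner ℝ v x) + Real.exp (-inner ℝ v x) := by
          rcases abs_choice (inner ℝ v x) with h | h <;> rw [h] <;>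
            linarith [Real.exp_pos (inner ℝ v x), Real.exp_pos (-inner ℝ v x)]
        have h2 : 0 ≤ ‖f x‖ * w x := mul_nonneg (norm_nonneg _) (hw0 x)
        rw [Real.norm_of_nonneg (mul_nonneg (Real.exp_pos _).le h2)]
        simp only [Pi.add_apply, Pi.mul_apply, inner_neg_left, ← hw]
        nlinarith [mul_le_mul_of_nonneg_right h1 h2])
    (.of_forall fun x => by
      refine HasSum.mul_right _ ?_
      rw [Complex.exp_eq_exp_ℂ]
      exact NormedSpace.expSeries_div_hasSum_exp _)
  simp_rw [h0] at key
  exact key.unique hasSum_zero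

open FourierTransform in
/-- An integrable function with vanishing Fourier transform vanishes almost everywhere: by duality
it is orthogonal to the Fourier transforms of all Schwartz functions, that is, to all Schwartz
functions. -/
lemma ae_eq_zero_of_fourier_eq_zero {n : ℕ} {g : EuclideanSpace ℝ (Fin n) → ℂ} (hg : Integrable g)
    (h : ∀ ξ, 𝓕 g ξ = 0) : ∀ᵐ x, g x = 0 := by
  refine ae_eq_zero_of_integral_contDiff_smul_eq_zero hg.locallyIntegrable fun χ hχ hc => ?_
  have hcC : HasCompactSupport fun x => (χ x : ℂ) := hc.comp_left (g := Complex.ofReal) rfl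
  let ψ : 𝓢(EuclideanSpace ℝ (Fin n), ℂ) :=
    hcC.toSchwartzMap (Complex.ofRealCLM.contDiff.comp hχ)
  let η : 𝓢(EuclideanSpace ℝ (Fin n), ℂ) := 𝓕⁻ ψ
  have e := VectorFourier.integral_fourierIntegral_smul_eq_flip (μ := volume) (ν := volume)
    (f := ⇑η) (g := g) (L := innerₗ (EuclideanSpace ℝ (Fin n)))
    Real.continuous_fourierChar continuous_inner η.integrable hg
  have e1 : VectorFourier.fourierIntegral Real.fourierChar volume
      (innerₗ (EuclideanSpace ℝ (Fin n))) ⇑η = fun x => (χ x : ℂ) := by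
    change 𝓕 ⇑η = _
    rw [← SchwartzMap.fourier_coe, FourierTransform.fourier_fourierInv_eq]
    rfl
  have e2 : VectorFourier.fourierIntegral Real.fourierChar volume
      (innerₗ (EuclideanSpace ℝ (Fin n))).flip g = 0 := by
    rw [flip_innerₗ]
    ext ξ
    exact h ξ
  rw [e1, e2] at e
  simpa using e

open FourierTransform in
/-- The Hermite functions form a complete system. -/
lemma eq_zero_of_inner_hermiteL2_eq_zero {n : ℕ} {f : L2 n}
    (hf : ∀ α, inner ℂ (hermiteL2 α) f = 0) : f = 0 := by
  have h0 := gaussianMoment_eq_zero hf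
  have hint : Integrable fun x => f x * (schwartzGaussian (EuclideanSpace ℝ (Fin n)) x : ℂ) :=
    integrable_schwartz_mul_L2 (postcompCLM Complex.ofRealCLM (schwartzGaussian _)) f
  have h := ae_eq_zero_of_fourier_eq_zero hint fun ξ => by
    rw [Real.fourier_eq', ← integral_exp_mul_gaussian_eq_zero h0 ((-2 * Real.pi) • ξ)]
    refine integral_congr_ae (.of_forall fun x => ?_)
    simp only [smul_eq_mul, inner_smul_left, real_inner_comm ξ x]
    simp
  rw [Lp.eq_zero_iff_ae_eq_zero]
  filter_upwards [h] with x hx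
  have hw : schwartzGaussian (EuclideanSpace ℝ (Fin n)) x ≠ 0 := (Real.exp_pos _).ne'
  simpa [hw] using hx

/-- The Hilbert basis of `L²(ℝⁿ)` consisting of Hermite functions. -/
noncomputable def hermiteBasis (n : ℕ) : HilbertBasis (Fin n → ℕ) ℂ (L2 n) :=
  HilbertBasis.mkOfOrthogonalEqBot (orthonormal_hermiteL2 n) <| by
    rw [Submodule.eq_bot_iff]
    intro f hf
    refine eq_zero_of_inner_hermiteL2_eq_zero fun α => ?_
    exact (Submodule.mem_orthogonal _ _).1 hf _ (Submodule.subset_span ⟨α, rfl⟩)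

@[simp]
lemma hermiteBasis_apply {n : ℕ} (α : Fin n → ℕ) : hermiteBasis n α = hermiteL2 α := by
  rw [hermiteBasis, HilbertBasis.coe_mkOfOrthogonalEqBot]

/-! ### The propagator of the harmonic oscillator -/

lemma hermiteBasis_repr_apply {n : ℕ} (f : L2 n) (α : Fin n → ℕ) :
    (hermiteBasis n).repr f α = inner ℂ (hermiteL2 α) f := by
  rw [HilbertBasis.repr_apply_apply, hermiteBasis_apply]

lemma hasSum_norm_sq_inner_hermiteL2 {n : ℕ} (f : L2 n) :
    HasSum (fun α => ‖inner ℂ (hermiteL2 α) f‖ ^ 2) (‖f‖ ^ 2) := by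
  have h := lp.hasSum_norm (p := 2) (by norm_num) ((hermiteBasis n).repr f)
  simp only [hermiteBasis_repr_apply, LinearIsometryEquiv.norm_map] at h
  simpa using h

lemma eq_of_inner_hermiteL2_eq {n : ℕ} {f g : L2 n}
    (h : ∀ α, inner ℂ (hermiteL2 α) f = inner ℂ (hermiteL2 α) g) : f = g := by
  rw [← sub_eq_zero]
  refine eq_zero_of_inner_hermiteL2_eq_zero fun α => ?_
  rw [inner_sub_right, h, sub_self]

/-- The phase `exp (-i λ_α t)`. -/
noncomputable def hermitePhase {n : ℕ} (t : ℝ) (α : Fin n → ℕ) : ℂ :=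
  Complex.exp (-(hermiteEigenvalue α * t : ℝ) * Complex.I)

lemma norm_hermitePhase {n : ℕ} (t : ℝ) (α : Fin n → ℕ) : ‖hermitePhase t α‖ = 1 := by
  rw [hermitePhase, ← Complex.ofReal_neg, Complex.norm_exp_ofReal_mul_I]

lemma hasDerivAt_hermitePhase {n : ℕ} (t : ℝ) (α : Fin n → ℕ) :
    HasDerivAt (fun s => hermitePhase s α)
      (-(hermiteEigenvalue α * Complex.I) * hermitePhase t α) t := by
  have h : HasDerivAt (fun s : ℝ => (-(hermiteEigenvalue α * s : ℝ) * Complex.I : ℂ))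
      (-(hermiteEigenvalue α * 1 : ℝ) * Complex.I) t :=
    (((hasDerivAt_id' t).const_mul _).ofReal_comp.neg).mul_const _
  convert! h.cexp using 1
  rw [hermitePhase]
  push_cast
  ring

lemma continuous_hermitePhase {n : ℕ} (α : Fin n → ℕ) :
    Continuous fun t => hermitePhase t α :=
  continuous_iff_continuousAt.2 fun t => (hasDerivAt_hermitePhase t α).continuousAt

lemma memℓp_hermitePhase_mul {n : ℕ} (t : ℝ) (f : L2 n) :
    Memℓp (fun α => hermitePhase t α * inner ℂ (hermiteL2 α) f) 2 := by
  rw [memℓp_gen_iff (by norm_num)]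
  simp only [norm_mul, norm_hermitePhase, one_mul]
  simpa using (hasSum_norm_sq_inner_hermiteL2 f).summable

/-- The unitary propagator `exp (-i t (-Δ + |x|²))`, acting diagonally on the Hermite functions. -/
noncomputable def hermitePropagator {n : ℕ} (t : ℝ) (f : L2 n) : L2 n :=
  (hermiteBasis n).repr.symm ⟨_, memℓp_hermitePhase_mul t f⟩

lemma inner_hermitePropagator {n : ℕ} (t : ℝ) (f : L2 n) (α : Fin n → ℕ) :
    inner ℂ (hermiteL2 α) (hermitePropagator t f) =
      hermitePhase t α * inner ℂ (hermiteL2 α) f := by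
  rw [← hermiteBasis_repr_apply, hermitePropagator, LinearIsometryEquiv.apply_symm_apply]

lemma hermitePropagator_zero {n : ℕ} (f : L2 n) : hermitePropagator 0 f = f :=
  eq_of_inner_hermiteL2_eq fun α => by
    rw [inner_hermitePropagator]
    simp [hermitePhase]

lemma hermitePropagator_sub {n : ℕ} (t : ℝ) (f g : L2 n) :
    hermitePropagator t (f - g) = hermitePropagator t f - hermitePropagator t g :=
  eq_of_inner_hermiteL2_eq fun α => by
    simp only [inner_hermitePropagator, inner_sub_right, mul_sub]

lemma norm_hermitePropagator {n : ℕ} (t : ℝ) (f : L2 n) : ‖hermitePropagator t f‖ = ‖f‖ := by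
  have h := hasSum_norm_sq_inner_hermiteL2 (hermitePropagator t f)
  simp only [inner_hermitePropagator, norm_mul, norm_hermitePhase, one_mul] at h
  have := h.unique (hasSum_norm_sq_inner_hermiteL2 f)
  exact (sq_eq_sq₀ (norm_nonneg _) (norm_nonneg _)).1 this

lemma continuous_hermitePropagator {n : ℕ} (f : L2 n) :
    Continuous fun t => hermitePropagator t f := by
  rw [continuous_iff_continuousAt]
  intro s
  have e : ∀ t, ‖hermitePropagator t f - hermitePropagator s f‖ ^ 2 =
      ∑' α, ‖(hermitePhase t α - hermitePhase s α) * inner ℂ (hermiteL2 α) f‖ ^ 2 := fun t => by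
    rw [← (hasSum_norm_sq_inner_hermiteL2 _).tsum_eq]
    simp only [inner_sub_right, inner_hermitePropagator, sub_mul]
  have hc : Continuous fun t =>
      ∑' α, ‖(hermitePhase t α - hermitePhase s α) * inner ℂ (hermiteL2 α) f‖ ^ 2 := by
    refine continuous_tsum (u := fun α => 4 * ‖inner ℂ (hermiteL2 α) f‖ ^ 2)
      (fun α => ?_) ((hasSum_norm_sq_inner_hermiteL2 f).summable.mul_left _) fun α t => ?_
    · exact (((continuous_hermitePhase α).sub continuous_const).mul continuous_const).norm.pow 2
    · have h2 : ‖hermitePhase t α - hermitePhase s α‖ ≤ 2 := by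
        refine (norm_sub_le _ _).trans ?_
        rw [norm_hermitePhase, norm_hermitePhase]
        norm_num
      rw [norm_pow, norm_norm, norm_mul, mul_pow]
      gcongr
      nlinarith [norm_nonneg (hermitePhase t α - hermitePhase s α)]
  have hl : Filter.Tendsto (fun t => ‖hermitePropagator t f - hermitePropagator s f‖ ^ 2)
      (nhds s) (nhds 0) := by
    simp_rw [e]
    have := hc.tendsto s
    simpa using this
  rw [ContinuousAt, tendsto_iff_norm_sub_tendsto_zero]
  have := hl.sqrt
  simpa [Real.sqrt_sq] using this

/-! ### Existence and uniqueness of the weak solution -/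

/-- The harmonic oscillator as an operator on Schwartz functions. -/
noncomputable def hermiteOpSchwartz {n : ℕ} (φ : 𝓢(EuclideanSpace ℝ (Fin n), ℂ)) :
    𝓢(EuclideanSpace ℝ (Fin n), ℂ) :=
  -(Δ φ) + smulLeftCLM ℂ (fun x : EuclideanSpace ℝ (Fin n) => ‖x‖ ^ 2) φ

@[simp]
lemma hermiteOpSchwartz_apply {n : ℕ} (φ : 𝓢(EuclideanSpace ℝ (Fin n), ℂ))
    (x : EuclideanSpace ℝ (Fin n)) : hermiteOpSchwartz φ x = hermiteOp φ x := by
  rw [hermiteOpSchwartz, hermiteOp, add_apply, neg_apply,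
    smulLeftCLM_apply_apply (Function.hasTemperateGrowth_norm_sq _), Complex.real_smul]

lemma integrable_schwartz_mul {n : ℕ} (φ ψ : 𝓢(EuclideanSpace ℝ (Fin n), ℂ)) :
    Integrable (fun x => φ x * ψ x) :=
  (φ.memLp 2 volume).integrable_mul (ψ.memLp 2 volume)

/-- The harmonic oscillator is symmetric for the bilinear pairing of Schwartz functions. -/
lemma integral_mul_hermiteOp {n : ℕ} (φ ψ : 𝓢(EuclideanSpace ℝ (Fin n), ℂ)) :
    ∫ x, φ x * hermiteOp ψ x = ∫ x, hermiteOp φ x * ψ x := by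
  have h := integral_mul_laplacian_right_eq_left (μ := volume) φ ψ
  let w : EuclideanSpace ℝ (Fin n) → ℝ := fun x => ‖x‖ ^ 2
  have hw : w.HasTemperateGrowth := Function.hasTemperateGrowth_norm_sq _
  have i1 := integrable_schwartz_mul φ (Δ ψ)
  have i2 := integrable_schwartz_mul (Δ φ) ψ
  have i3 := integrable_schwartz_mul φ (smulLeftCLM ℂ w ψ)
  have e1 : ∀ x, φ x * hermiteOp ψ x = φ x * smulLeftCLM ℂ w ψ x - φ x * Δ ψ x := fun x => by
    rw [hermiteOp, smulLeftCLM_apply_apply hw, Complex.real_smul]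
    ring
  have e2 : ∀ x, hermiteOp φ x * ψ x = φ x * smulLeftCLM ℂ w ψ x - Δ φ x * ψ x := fun x => by
    rw [hermiteOp, smulLeftCLM_apply_apply hw, Complex.real_smul]
    ring
  simp_rw [e1, e2]
  rw [integral_sub i3 i1, integral_sub i3 i2, h]

lemma integral_hermiteSchwartz_mul_hermiteOp {n : ℕ} (α : Fin n → ℕ)
    (φ : 𝓢(EuclideanSpace ℝ (Fin n), ℂ)) :
    ∫ x, hermiteSchwartz α x * hermiteOp φ x =
      hermiteEigenvalue α * ∫ x, hermiteSchwartz α x * φ x := by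
  rw [integral_mul_hermiteOp, ← integral_const_mul]
  simp_rw [hermiteOp_hermiteSchwartz, mul_assoc]

/-- Parseval's identity for the bilinear pairing of an `L²` function with a Schwartz function. -/
lemma hasSum_integral_mul {n : ℕ} (v : L2 n) (φ : 𝓢(EuclideanSpace ℝ (Fin n), ℂ)) :
    HasSum (fun α => (∫ x, hermiteSchwartz α x * φ x) * inner ℂ (hermiteL2 α) v)
      (∫ x, v x * φ x) := by
  -- conjugating `φ` turns the bilinear pairing into the inner product
  let ψ : 𝓢(EuclideanSpace ℝ (Fin n), ℂ) := postcompCLM (Complex.conjCLE : ℂ →L[ℝ] ℂ) φ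
  have hψ : ∀ w : L2 n, inner ℂ (ψ.toLp 2 volume) w = ∫ x, w x * φ x := fun w => by
    rw [L2.inner_def]
    refine integral_congr_ae ?_
    filter_upwards [ψ.coeFn_toLp 2 volume] with x hx
    rw [hx]
    simp [ψ]
  have h := (hermiteBasis n).hasSum_inner_mul_inner (ψ.toLp 2 volume) v
  rw [hψ] at h
  convert! h using 2 with α
  rw [hψ, hermiteBasis_apply]
  congr 1
  refine integral_congr_ae ?_
  filter_upwards [coeFn_hermiteL2 α] with x hx
  rw [hx, hermiteSchwartz_apply]

lemma hasDerivAt_tsum_hermitePhase {n : ℕ} {a c : (Fin n → ℕ) → ℂ}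
    (h0 : Summable fun α => a α * c α) (h1 : Summable fun α => hermiteEigenvalue α * a α * c α)
    (t : ℝ) :
    HasDerivAt (fun s => ∑' α, Complex.I * (a α * (hermitePhase s α * c α)))
      (∑' α, hermiteEigenvalue α * a α * (hermitePhase t α * c α)) t := by
  refine hasDerivAt_tsum h1.norm (g' := fun α s => hermiteEigenvalue α * a α *
    (hermitePhase s α * c α)) (fun α s => ?_) (fun α s => ?_) (y₀ := 0) ?_ t
  · refine ((((hasDerivAt_hermitePhase s α).mul_const (c α)).const_mul (a α)).const_mul
      Complex.I).congr_deriv ?_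
    linear_combination (-(hermiteEigenvalue α * a α * (hermitePhase s α * c α))) * Complex.I_sq
  · simp only [norm_mul, norm_hermitePhase, one_mul, le_refl]
  · simpa [hermitePhase] using h0.mul_left Complex.I

theorem isSchrodingerSolution_hermitePropagator {n : ℕ} (f : L2 n) :
    IsSchrodingerSolution f fun t => hermitePropagator t f where
  continuous := continuous_hermitePropagator f
  initial := hermitePropagator_zero f
  equation φ t := by
    have h1 := fun s => hasSum_integral_mul (hermitePropagator s f) φ
    have h2 := fun v : L2 n => hasSum_integral_mul v (hermiteOpSchwartz φ)
    simp only [hermiteOpSchwartz_apply, integral_hermiteSchwartz_mul_hermiteOp] at h2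
    simp_rw [inner_hermitePropagator] at h1
    have h3 := h2 (hermitePropagator t f)
    simp_rw [inner_hermitePropagator] at h3
    have key := hasDerivAt_tsum_hermitePhase (hasSum_integral_mul f φ).summable (h2 f).summable t
    rw [h3.tsum_eq] at key
    have e : (fun s => Complex.I * ∫ x, hermitePropagator s f x * φ x) = fun s => ∑' α,
        Complex.I * ((∫ x, hermiteSchwartz α x * φ x) *
          (hermitePhase s α * inner ℂ (hermiteL2 α) f)) := by
      ext s
      exact ((h1 s).mul_left Complex.I).tsum_eq.symm
    rw [e]
    exact key

/-- Testing the equation with a Hermite function gives a scalar linear differential equation for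
the corresponding coefficient. -/
lemma IsSchrodingerSolution.eq_hermitePropagator {n : ℕ} {f : L2 n} {u : ℝ → L2 n}
    (hu : IsSchrodingerSolution f u) (t : ℝ) : u t = hermitePropagator t f := by
  refine eq_of_inner_hermiteL2_eq fun α => ?_
  rw [inner_hermitePropagator]
  set q : ℝ → ℂ := fun s => inner ℂ (hermiteL2 α) (u s) with hq
  have hd : ∀ s, HasDerivAt q (-(hermiteEigenvalue α * Complex.I) * q s) s := by
    intro s
    have h := hu.equation (hermiteSchwartz α) s
    simp_rw [hermiteOp_hermiteSchwartz, ← inner_hermiteL2_left] at h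
    have e : ∫ x, u s x * (hermiteEigenvalue α * hermiteSchwartz α x) =
        hermiteEigenvalue α * q s := by
      rw [hq]
      simp only
      rw [inner_hermiteL2_left, ← integral_const_mul]
      congr 1
      ext x
      ring
    rw [e] at h
    convert! h.const_mul (-Complex.I) using 1
    · ext r
      rw [hq]
      linear_combination (inner ℂ (hermiteL2 α) (u r)) * Complex.I_sq
    · ring
  have hp : ∀ s, hermitePhase (-s) α * hermitePhase s α = 1 := fun s => by
    rw [hermitePhase, hermitePhase, ← Complex.exp_add]
    simp
  have hd2 : ∀ s, HasDerivAt (fun r => hermitePhase (-r) α * q r) 0 s := by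
    intro s
    have h1 : HasDerivAt (fun r => hermitePhase (-r) α)
        (-(-(hermiteEigenvalue α * Complex.I) * hermitePhase (-s) α)) s := by
      have := (hasDerivAt_hermitePhase (-s) α).scomp s (hasDerivAt_neg s)
      simpa [Function.comp_def] using this
    convert! h1.mul (hd s) using 1
    ring
  have hconst := is_const_of_deriv_eq_zero (fun s => (hd2 s).differentiableAt)
    (fun s => (hd2 s).deriv) t 0
  have h0 : hermitePhase (-0) α * q 0 = inner ℂ (hermiteL2 α) f := by
    rw [hq]
    simp [hu.initial, hermitePhase]
  rw [h0] at hconst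
  rw [← hconst, ← mul_assoc, mul_comm (hermitePhase t α), hp, one_mul]

/-! ### Weighted matrix elements of the Hermite functions -/

/-- The weight `|a| ^ (-δ)` on `[-1, 1]`, extended by zero. -/
noncomputable def nearWeight (δ : ℝ) : ℝ → ℝ := (Set.Icc (-1) 1).indicator fun a => |a| ^ (-δ)

lemma nearWeight_nonneg (δ a : ℝ) : 0 ≤ nearWeight δ a :=
  Set.indicator_nonneg (fun _ _ => Real.rpow_nonneg (abs_nonneg _) _) a

lemma measurable_nearWeight (δ : ℝ) : Measurable (nearWeight δ) :=
  ((by fun_prop : Measurable fun a : ℝ => |a|).pow_const (-δ)).indicator measurableSet_Icc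

lemma integrable_nearWeight {δ : ℝ} (hδ : δ < 1) : Integrable (nearWeight δ) := by
  rw [nearWeight, integrable_indicator_iff measurableSet_Icc, integrableOn_Icc_iff_integrableOn_Ioc,
    ← intervalIntegrable_iff_integrableOn_Ioc_of_le (by norm_num)]
  have h : ∀ a : ℝ, a = 1 ∨ a = -1 → IntervalIntegrable (fun a : ℝ => |a| ^ (-δ)) volume 0 a := by
    have h1 : IntervalIntegrable (fun a : ℝ => |a| ^ (-δ)) volume 0 1 := by
      refine (intervalIntegral.intervalIntegrable_rpow' (r := -δ) (by linarith)).congr ?_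
      intro a ha
      rw [Set.uIoc_of_le zero_le_one] at ha
      simp only [abs_of_pos ha.1]
    rintro a (rfl | rfl)
    · exact h1
    · rw [IntervalIntegrable.iff_comp_neg]
      simpa using h1
  exact (h (-1) (Or.inr rfl)).symm.trans (h 1 (Or.inl rfl))

lemma nearWeight_mul_abs_hermiteFun_le (δ : ℝ) (a b : ℕ) (y : ℝ) :
    ‖nearWeight δ y * (hermiteFun a y * hermiteFun b y)‖ ≤
      nearWeight δ y * (4 * (hermiteDecay a * hermiteDecay b)) := by
  rw [norm_mul, Real.norm_of_nonneg (nearWeight_nonneg _ _)]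
  by_cases hy : y ∈ Set.Icc (-1 : ℝ) 1
  · have hy' : |y| ≤ 1 := abs_le.2 hy
    refine mul_le_mul_of_nonneg_left ?_ (nearWeight_nonneg _ _)
    rw [norm_mul, Real.norm_eq_abs, Real.norm_eq_abs]
    calc |hermiteFun a y| * |hermiteFun b y|
        ≤ (2 * hermiteDecay a) * (2 * hermiteDecay b) :=
          mul_le_mul (abs_hermiteFun_le a hy') (abs_hermiteFun_le b hy') (abs_nonneg _)
            (by have := hermiteDecay_nonneg a; positivity)
      _ = _ := by ring
  · simp [nearWeight, hy]

lemma integrable_nearWeight_mul {δ : ℝ} (hδ : δ < 1) (a b : ℕ) :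
    Integrable fun y => nearWeight δ y * (hermiteFun a y * hermiteFun b y) :=
  ((integrable_nearWeight hδ).mul_const _).mono'
    ((measurable_nearWeight δ).mul ((continuous_hermiteFun a).mul
      (continuous_hermiteFun b)).measurable).aestronglyMeasurable
    (.of_forall (nearWeight_mul_abs_hermiteFun_le δ a b))

lemma abs_integral_nearWeight_mul_le {δ : ℝ} (hδ : δ < 1) (a b : ℕ) :
    |∫ y, nearWeight δ y * (hermiteFun a y * hermiteFun b y)| ≤
      4 * (∫ y, nearWeight δ y) * (hermiteDecay a * hermiteDecay b) := by
  have h := norm_integral_le_of_norm_le ((integrable_nearWeight hδ).mul_const _)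
    (.of_forall (nearWeight_mul_abs_hermiteFun_le δ a b))
  rw [integral_mul_const] at h
  rw [← Real.norm_eq_abs]
  linarith

/-- The weight `|x_i| ^ (-δ) |x_j| ^ (-δ)` localised to the square `|x_i|, |x_j| ≤ 1`. -/
noncomputable def pairWeight {n : ℕ} (δ : ℝ) (i j : Fin n) (x : EuclideanSpace ℝ (Fin n)) : ℝ :=
  nearWeight δ (x i) * nearWeight δ (x j)

lemma pairWeight_nonneg {n : ℕ} (δ : ℝ) (i j : Fin n) (x : EuclideanSpace ℝ (Fin n)) :
    0 ≤ pairWeight δ i j x :=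
  mul_nonneg (nearWeight_nonneg _ _) (nearWeight_nonneg _ _)

lemma measurable_pairWeight {n : ℕ} (δ : ℝ) (i j : Fin n) : Measurable (pairWeight δ i j) := by
  have h := fun l : Fin n => (measurable_nearWeight δ).comp
    (EuclideanSpace.proj l : EuclideanSpace ℝ (Fin n) →L[ℝ] ℝ).continuous.measurable
  exact (h i).mul (h j)

/-- The factor of `pairWeight` carried by the coordinate `l`. -/
noncomputable def pairWeightFactor {n : ℕ} (δ : ℝ) (i j l : Fin n) (y : ℝ) : ℝ :=
  if l = i ∨ l = j then nearWeight δ y else 1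

lemma pairWeight_mul_hermiteProd {n : ℕ} (δ : ℝ) {i j : Fin n} (hij : i ≠ j) (α β : Fin n → ℕ)
    (x : EuclideanSpace ℝ (Fin n)) :
    pairWeight δ i j x * (hermiteProd α x * hermiteProd β x) =
      ∏ l, pairWeightFactor δ i j l (x l) * (hermiteFun (α l) (x l) * hermiteFun (β l) (x l)) := by
  rw [Finset.prod_mul_distrib, Finset.prod_mul_distrib, hermiteProd, hermiteProd, pairWeight]
  congr 1
  rw [Finset.prod_eq_mul i j hij (fun l _ hl => ?_) (by simp) (by simp)]
  · simp [pairWeightFactor]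
  · simp [pairWeightFactor, hl.1, hl.2]

lemma integrable_pairWeightFactor_mul {n : ℕ} {δ : ℝ} (hδ : δ < 1) (i j l : Fin n) (a b : ℕ) :
    Integrable fun y => pairWeightFactor δ i j l y * (hermiteFun a y * hermiteFun b y) := by
  by_cases hl : l = i ∨ l = j
  · simpa only [pairWeightFactor, if_pos hl] using integrable_nearWeight_mul hδ a b
  · simpa only [pairWeightFactor, if_neg hl, one_mul] using integrable_hermiteFun_mul a b

lemma integrable_pairWeight_mul {n : ℕ} {δ : ℝ} (hδ : δ < 1) {i j : Fin n} (hij : i ≠ j)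
    (α β : Fin n → ℕ) :
    Integrable fun x => pairWeight δ i j x * (hermiteProd α x * hermiteProd β x) := by
  simp_rw [pairWeight_mul_hermiteProd δ hij]
  exact integrable_euclidean_prod fun l => integrable_pairWeightFactor_mul hδ i j l (α l) (β l)

/-- The matrix elements of the weight in the Hermite basis. -/
noncomputable def pairMatrix {n : ℕ} (δ : ℝ) (i j : Fin n) (α β : Fin n → ℕ) : ℝ :=
  ∫ x, pairWeight δ i j x * (hermiteProd α x * hermiteProd β x)

/-- The decay factor of a multi-index in the two distinguished directions. -/
noncomputable def pairDecay {n : ℕ} (i j : Fin n) (α : Fin n → ℕ) : ℝ :=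
  hermiteDecay (α i) * hermiteDecay (α j)

/-- The weight only involves the coordinates `i` and `j`, hence its matrix elements vanish unless
the multi-indices agree in all other directions. -/
lemma pairMatrix_eq_zero {n : ℕ} (δ : ℝ) {i j : Fin n} (hij : i ≠ j) {α β : Fin n → ℕ}
    {l : Fin n} (hi : l ≠ i) (hj : l ≠ j) (hl : α l ≠ β l) : pairMatrix δ i j α β = 0 := by
  rw [pairMatrix]
  simp_rw [pairWeight_mul_hermiteProd δ hij]
  rw [integral_euclidean_prod (fun l y =>
    pairWeightFactor δ i j l y * (hermiteFun (α l) y * hermiteFun (β l) y))]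
  refine Finset.prod_eq_zero (Finset.mem_univ l) ?_
  simp [pairWeightFactor, hi, hj, integral_hermiteFun_mul, hl]

lemma abs_pairMatrix_le {n : ℕ} {δ : ℝ} (hδ : δ < 1) {i j : Fin n} (hij : i ≠ j)
    (α β : Fin n → ℕ) :
    |pairMatrix δ i j α β| ≤
      (4 * ∫ y, nearWeight δ y) ^ 2 * (pairDecay i j α * pairDecay i j β) := by
  have hR : 0 ≤ ∫ y, nearWeight δ y := integral_nonneg (nearWeight_nonneg δ)
  have hd := hermiteDecay_nonneg
  by_cases h : ∀ l, l ≠ i → l ≠ j → α l = β l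
  · rw [pairMatrix]
    simp_rw [pairWeight_mul_hermiteProd δ hij]
    rw [integral_euclidean_prod (fun l y =>
      pairWeightFactor δ i j l y * (hermiteFun (α l) y * hermiteFun (β l) y)),
      Finset.prod_eq_mul i j hij (fun l _ hl => ?_) (by simp) (by simp), abs_mul]
    · simp only [pairWeightFactor, true_or, or_true, if_true]
      calc _ ≤ (4 * (∫ y, nearWeight δ y) * (hermiteDecay (α i) * hermiteDecay (β i))) *
            (4 * (∫ y, nearWeight δ y) * (hermiteDecay (α j) * hermiteDecay (β j))) :=
            mul_le_mul (abs_integral_nearWeight_mul_le hδ _ _)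
              (abs_integral_nearWeight_mul_le hδ _ _) (abs_nonneg _)
              (by have := hd (α i); have := hd (β i); positivity)
        _ = _ := by rw [pairDecay, pairDecay]; ring
    · simp [pairWeightFactor, hl.1, hl.2, integral_hermiteFun_mul, h l hl.1 hl.2]
  · push Not at h
    obtain ⟨l, hi, hj, hl⟩ := h
    rw [pairMatrix_eq_zero δ hij hi hj hl, abs_zero]
    have h1 := hd (α i)
    have h2 := hd (β i)
    have h3 := hd (α j)
    have h4 := hd (β j)
    unfold pairDecay
    positivity

/-! ### The row sums of the resonant matrix -/

lemma sum_one_div_sqrt_le (N : ℕ) : ∑ m ∈ Finset.range N, 1 / √((m : ℝ) + 1) ≤ 2 * √N := by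
  induction N with
  | zero => simp
  | succ N ih =>
    rw [Finset.sum_range_succ]
    have hb : 0 < √((N : ℝ) + 1) := Real.sqrt_pos.2 (by positivity)
    have ha := Real.sqrt_nonneg (N : ℝ)
    have hb2 := Real.sq_sqrt (show (0 : ℝ) ≤ N + 1 by positivity)
    have ha2 := Real.sq_sqrt (show (0 : ℝ) ≤ N by positivity)
    have : 1 / √((N : ℝ) + 1) ≤ 2 * √(N + 1) - 2 * √N := by
      rw [div_le_iff₀ hb]
      nlinarith [sq_nonneg (√((N : ℝ) + 1) - √N)]
    push_cast
    linarith

/-- The convolution `∑_{a + b = k} ((a + 1) (b + 1)) ^ (-1/2)` is bounded uniformly in `k`. -/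
lemma sum_one_div_sqrt_mul_le (k : ℕ) :
    ∑ m ∈ Finset.range (k + 1), 1 / √((m : ℝ) + 1) * (1 / √(((k - m : ℕ) : ℝ) + 1)) ≤ 4 := by
  have hK : (0 : ℝ) < k + 2 := by positivity
  -- with `a = m + 1` and `b = k - m + 1`, this is `√(a + b) ≤ √a + √b` divided by `√a √b √(a + b)`
  have h1 : ∀ m ∈ Finset.range (k + 1),
      1 / √((m : ℝ) + 1) * (1 / √(((k - m : ℕ) : ℝ) + 1)) ≤
        (1 / √((m : ℝ) + 1) + 1 / √(((k - m : ℕ) : ℝ) + 1)) / √(k + 2) := by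
    intro m hm
    have hmk : m ≤ k := by simpa [Nat.lt_succ_iff] using hm
    rw [Nat.cast_sub hmk]
    have hmk' : (m : ℝ) ≤ k := by exact_mod_cast hmk
    have hm0 : (0 : ℝ) ≤ m := m.cast_nonneg
    have ha : 0 < √((m : ℝ) + 1) := Real.sqrt_pos.2 (by positivity)
    have hb : 0 < √((k : ℝ) - m + 1) := Real.sqrt_pos.2 (by linarith)
    have hc : 0 < √((k : ℝ) + 2) := Real.sqrt_pos.2 hK
    have ha2 := Real.sq_sqrt (show (0 : ℝ) ≤ m + 1 by positivity)
    have hb2 := Real.sq_sqrt (show (0 : ℝ) ≤ (k : ℝ) - m + 1 by linarith)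
    have hc2 := Real.sq_sqrt hK.le
    have hle : √((k : ℝ) + 2) ≤ √((m : ℝ) + 1) + √((k : ℝ) - m + 1) := by
      refine Real.sqrt_le_iff.2 ⟨by positivity, ?_⟩
      nlinarith [mul_pos ha hb]
    rw [div_add_div _ _ ha.ne' hb.ne', div_mul_div_comm, div_div,
      div_le_div_iff₀ (by positivity) (by positivity)]
    nlinarith [mul_le_mul_of_nonneg_left hle (mul_pos ha hb).le]
  refine (Finset.sum_le_sum h1).trans ?_
  rw [← Finset.sum_div, Finset.sum_add_distrib]
  have h2 : ∑ m ∈ Finset.range (k + 1), 1 / √(((k - m : ℕ) : ℝ) + 1) =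
      ∑ m ∈ Finset.range (k + 1), 1 / √((m : ℝ) + 1) := by
    rw [← Finset.sum_range_reflect]
    refine Finset.sum_congr rfl fun m hm => ?_
    have : m ≤ k := by simpa [Nat.lt_succ_iff] using hm
    congr 4
    omega
  have h3 := sum_one_div_sqrt_le (k + 1)
  have h4 : √((k + 1 : ℕ) : ℝ) ≤ √((k : ℝ) + 2) := Real.sqrt_le_sqrt (by push_cast; linarith)
  rw [h2, div_le_iff₀ (Real.sqrt_pos.2 hK)]
  linarith

/-- Two multi-indices are resonant for the pair `i, j` when they agree in all other directions and
belong to the same eigenvalue. -/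
def IsResonant {n : ℕ} (i j : Fin n) (α β : Fin n → ℕ) : Prop :=
  (∀ l, l ≠ i → l ≠ j → α l = β l) ∧ ∑ l, α l = ∑ l, β l

lemma IsResonant.symm {n : ℕ} {i j : Fin n} {α β : Fin n → ℕ} (h : IsResonant i j α β) :
    IsResonant i j β α :=
  ⟨fun l hi hj => (h.1 l hi hj).symm, h.2.symm⟩

lemma IsResonant.add_eq {n : ℕ} {i j : Fin n} (hij : i ≠ j) {α β : Fin n → ℕ}
    (h : IsResonant i j α β) : α i + α j = β i + β j := by
  have key : ∀ γ : Fin n → ℕ,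
      ∑ l, γ l = γ i + (γ j + ∑ l ∈ (Finset.univ.erase i).erase j, γ l) := fun γ => by
    rw [Finset.add_sum_erase _ _ (by simpa using hij.symm),
      Finset.add_sum_erase _ _ (Finset.mem_univ i)]
  have h2 := h.2
  rw [key α, key β] at h2
  have h3 : ∑ l ∈ (Finset.univ.erase i).erase j, α l =
      ∑ l ∈ (Finset.univ.erase i).erase j, β l :=
    Finset.sum_congr rfl fun l hl => h.1 l (by simp at hl; tauto) (by simp at hl; tauto)
  omega

open Classical in
lemma sum_pairDecay_sq_le {n : ℕ} {i j : Fin n} (hij : i ≠ j) (S : Finset (Fin n → ℕ))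
    (α : Fin n → ℕ) : ∑ β ∈ S with IsResonant i j α β, pairDecay i j β ^ 2 ≤ 4 := by
  set k := α i + α j with hk
  let F : ℕ → ℝ := fun m => 1 / √((m : ℝ) + 1) * (1 / √(((k - m : ℕ) : ℝ) + 1))
  set T := S.filter fun β => IsResonant i j α β with hT
  have hadd : ∀ β ∈ T, β i + β j = k := fun β hβ =>
    ((Finset.mem_filter.1 hβ).2.add_eq hij).symm
  have h1 : ∀ β ∈ T, pairDecay i j β ^ 2 = F (β i) := by
    intro β hβ
    have : k - β i = β j := by have := hadd β hβ; omega
    rw [pairDecay, mul_pow, hermiteDecay_sq, hermiteDecay_sq]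
    simp only [F, this]
  have hinj : Set.InjOn (fun β : Fin n → ℕ => β i) T := by
    intro β hβ γ hγ hβγ
    have hb := Finset.mem_filter.1 (Finset.mem_coe.1 hβ)
    have hc := Finset.mem_filter.1 (Finset.mem_coe.1 hγ)
    have h1 := hadd β hβ
    have h2 := hadd γ hγ
    simp only at hβγ
    ext l
    by_cases hi : l = i
    · rw [hi, hβγ]
    by_cases hj : l = j
    · rw [hj]; omega
    rw [← hb.2.1 l hi hj, hc.2.1 l hi hj]
  rw [Finset.sum_congr rfl h1, ← Finset.sum_image (f := F) hinj]
  refine (Finset.sum_le_sum_of_subset_of_nonneg ?_ fun m _ _ => by positivity).trans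
    (sum_one_div_sqrt_mul_le k)
  intro m hm
  obtain ⟨β, hβ, rfl⟩ := Finset.mem_image.1 hm
  have := hadd β hβ
  simp only [Finset.mem_range]
  omega

open Classical in
/-- Schur's test for the resonant part of the matrix. -/
lemma sum_resonant_le {n : ℕ} {i j : Fin n} (hij : i ≠ j) (S : Finset (Fin n → ℕ))
    (c : (Fin n → ℕ) → ℝ) :
    ∑ α ∈ S, ∑ β ∈ S, (if IsResonant i j α β then
      (c α * c β) * (pairDecay i j α * pairDecay i j β) else 0) ≤ 4 * ∑ α ∈ S, c α ^ 2 := by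
  set A : ℝ := ∑ α ∈ S, ∑ β ∈ S, (if IsResonant i j α β then c α ^ 2 * pairDecay i j β ^ 2 else 0)
    with hA
  have hA' : ∑ α ∈ S, ∑ β ∈ S,
      (if IsResonant i j α β then c β ^ 2 * pairDecay i j α ^ 2 else 0) = A := by
    rw [hA, Finset.sum_comm]
    refine Finset.sum_congr rfl fun α _ => Finset.sum_congr rfl fun β _ => ?_
    simp only [show IsResonant i j β α ↔ IsResonant i j α β from ⟨.symm, .symm⟩]
  have hA4 : A ≤ 4 * ∑ α ∈ S, c α ^ 2 := by
    rw [hA, Finset.mul_sum]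
    refine Finset.sum_le_sum fun α _ => ?_
    rw [← Finset.sum_filter, ← Finset.mul_sum, mul_comm]
    exact mul_le_mul_of_nonneg_right (sum_pairDecay_sq_le hij S α) (sq_nonneg _)
  have h2 : ∑ α ∈ S, ∑ β ∈ S, (if IsResonant i j α β then
      (c α * c β) * (pairDecay i j α * pairDecay i j β) else 0) ≤ (A + A) / 2 := by
    nth_rw 2 [← hA']
    rw [hA, ← Finset.sum_add_distrib, Finset.sum_div]
    refine Finset.sum_le_sum fun α _ => ?_
    rw [← Finset.sum_add_distrib, Finset.sum_div]
    refine Finset.sum_le_sum fun β _ => ?_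
    split_ifs
    · nlinarith [sq_nonneg (c α * pairDecay i j β - c β * pairDecay i j α)]
    · simp
  linarith

/-! ### The estimate for finite Hermite expansions -/

lemma integral_hermitePhase_mul_conj {n : ℕ} (α β : Fin n → ℕ) :
    ∫ t in (0 : ℝ)..(2 * Real.pi), hermitePhase t α * (starRingEnd ℂ) (hermitePhase t β) =
      if ∑ l, α l = ∑ l, β l then ((2 * Real.pi : ℝ) : ℂ) else 0 := by
  set m : ℤ := ∑ l, (β l : ℤ) - ∑ l, (α l : ℤ) with hm
  have hlam : hermiteEigenvalue β - hermiteEigenvalue α = 2 * (m : ℝ) := by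
    rw [hermiteEigenvalue, hermiteEigenvalue, ← Finset.sum_sub_distrib, hm]
    push_cast
    rw [← Finset.sum_sub_distrib, Finset.mul_sum]
    exact Finset.sum_congr rfl fun l _ => by ring
  have e : ∀ t : ℝ, hermitePhase t α * (starRingEnd ℂ) (hermitePhase t β) =
      Complex.exp ((2 * m * Complex.I) * t) := by
    intro t
    rw [hermitePhase, hermitePhase, ← Complex.exp_conj, ← Complex.exp_add]
    congr 1
    have hlam' : (hermiteEigenvalue β : ℂ) - hermiteEigenvalue α = 2 * m := by exact_mod_cast hlam
    simp only [map_mul, map_neg, Complex.conj_ofReal, Complex.conj_I]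
    push_cast
    linear_combination (t * Complex.I) * hlam'
  simp_rw [e]
  by_cases h : ∑ l, α l = ∑ l, β l
  · have hm0 : m = 0 := by
      rw [hm]
      have : ∑ l, (α l : ℤ) = ∑ l, (β l : ℤ) := by exact_mod_cast h
      rw [this, sub_self]
    rw [if_pos h, hm0]
    simp
  · have hm0 : m ≠ 0 := by
      intro h0
      apply h
      have : ∑ l, (β l : ℤ) = ∑ l, (α l : ℤ) := sub_eq_zero.1 h0
      exact_mod_cast this.symm
    have hc : (2 * m * Complex.I : ℂ) ≠ 0 := by simp [hm0]
    rw [if_neg h, integral_exp_mul_complex hc]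
    have : Complex.exp (2 * m * Complex.I * ((2 * Real.pi : ℝ) : ℂ)) = 1 := by
      rw [← Complex.exp_int_mul_two_pi_mul_I (2 * m)]
      congr 1
      push_cast
      ring
    rw [this]
    simp

/-- The coefficient `Re (e^{-i λ_α t} c_α conj (e^{-i λ_β t} c_β))` of the expansion of the
squared modulus. -/
noncomputable def phaseCoeff {n : ℕ} (c : (Fin n → ℕ) → ℂ) (α β : Fin n → ℕ) (t : ℝ) : ℝ :=
  ((hermitePhase t α * c α) * (starRingEnd ℂ) (hermitePhase t β * c β)).re

lemma continuous_phaseCoeff {n : ℕ} (c : (Fin n → ℕ) → ℂ) (α β : Fin n → ℕ) :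
    Continuous (phaseCoeff c α β) :=
  Complex.continuous_re.comp (((continuous_hermitePhase α).mul continuous_const).mul
    (Complex.continuous_conj.comp ((continuous_hermitePhase β).mul continuous_const)))

lemma abs_integral_phaseCoeff_le {n : ℕ} (c : (Fin n → ℕ) → ℂ) (α β : Fin n → ℕ) :
    |∫ t in (0 : ℝ)..(2 * Real.pi), phaseCoeff c α β t| ≤
      if ∑ l, α l = ∑ l, β l then 2 * Real.pi * (‖c α‖ * ‖c β‖) else 0 := by
  have e : ∀ t, (hermitePhase t α * c α) * (starRingEnd ℂ) (hermitePhase t β * c β) =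
      (hermitePhase t α * (starRingEnd ℂ) (hermitePhase t β)) *
        (c α * (starRingEnd ℂ) (c β)) := fun t => by
    rw [map_mul]
    ring
  have hint : IntervalIntegrable (fun t => (hermitePhase t α * c α) *
      (starRingEnd ℂ) (hermitePhase t β * c β)) volume 0 (2 * Real.pi) :=
    (((continuous_hermitePhase α).mul continuous_const).mul (Complex.continuous_conj.comp
      ((continuous_hermitePhase β).mul continuous_const))).intervalIntegrable _ _
  have h1 := Complex.reCLM.intervalIntegral_comp_comm hint
  simp only [Complex.reCLM_apply] at h1
  simp only [phaseCoeff]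
  rw [h1]
  refine (Complex.abs_re_le_norm _).trans ?_
  simp_rw [e]
  rw [intervalIntegral.integral_mul_const, integral_hermitePhase_mul_conj, norm_mul, norm_mul,
    RCLike.norm_conj]
  split_ifs
  · rw [Complex.norm_real, Real.norm_of_nonneg (by positivity)]
  · simp

/-- The evolution of a finite Hermite expansion, as a function defined everywhere. -/
noncomputable def finiteEvolution {n : ℕ} (S : Finset (Fin n → ℕ)) (c : (Fin n → ℕ) → ℂ) (t : ℝ)
    (x : EuclideanSpace ℝ (Fin n)) : ℂ :=
  ∑ α ∈ S, hermitePhase t α * c α * hermiteProd α x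

lemma continuous_finiteEvolution {n : ℕ} (S : Finset (Fin n → ℕ)) (c : (Fin n → ℕ) → ℂ) (t : ℝ) :
    Continuous (finiteEvolution S c t) :=
  continuous_finsetSum _ fun α _ =>
    continuous_const.mul (Complex.continuous_ofReal.comp (continuous_hermiteProd α))

lemma norm_finiteEvolution_sq {n : ℕ} (S : Finset (Fin n → ℕ)) (c : (Fin n → ℕ) → ℂ) (t : ℝ)
    (x : EuclideanSpace ℝ (Fin n)) :
    ‖finiteEvolution S c t x‖ ^ 2 =
      ∑ α ∈ S, ∑ β ∈ S, phaseCoeff c α β t * (hermiteProd α x * hermiteProd β x) := by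
  have h : ((‖finiteEvolution S c t x‖ ^ 2 : ℝ) : ℂ) =
      finiteEvolution S c t x * (starRingEnd ℂ) (finiteEvolution S c t x) := by
    rw [Complex.mul_conj, Complex.normSq_eq_norm_sq]
  have h2 := congrArg Complex.re h
  rw [Complex.ofReal_re] at h2
  rw [h2, finiteEvolution, map_sum, Finset.sum_mul_sum, Complex.re_sum]
  refine Finset.sum_congr rfl fun α _ => ?_
  rw [Complex.re_sum]
  refine Finset.sum_congr rfl fun β _ => ?_
  rw [map_mul, Complex.conj_ofReal, phaseCoeff, ← Complex.re_mul_ofReal]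
  congr 1
  push_cast
  ring

/-- The weighted mass of a finite Hermite expansion at time `t`. -/
noncomputable def finiteMass {n : ℕ} (δ : ℝ) (i j : Fin n) (S : Finset (Fin n → ℕ))
    (c : (Fin n → ℕ) → ℂ) (t : ℝ) : ℝ :=
  ∑ α ∈ S, ∑ β ∈ S, phaseCoeff c α β t * pairMatrix δ i j α β

lemma continuous_finiteMass {n : ℕ} (δ : ℝ) (i j : Fin n) (S : Finset (Fin n → ℕ))
    (c : (Fin n → ℕ) → ℂ) : Continuous (finiteMass δ i j S c) :=
  continuous_finsetSum _ fun α _ => continuous_finsetSum _ fun β _ =>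
    (continuous_phaseCoeff c α β).mul continuous_const

lemma lintegral_pairWeight_finiteEvolution {n : ℕ} {δ : ℝ} (hδ : δ < 1) {i j : Fin n}
    (hij : i ≠ j) (S : Finset (Fin n → ℕ)) (c : (Fin n → ℕ) → ℂ) (t : ℝ) :
    0 ≤ finiteMass δ i j S c t ∧
    ∫⁻ x, ‖finiteEvolution S c t x‖ₑ ^ 2 * ENNReal.ofReal (pairWeight δ i j x) =
      ENNReal.ofReal (finiteMass δ i j S c t) := by
  have hW := pairWeight_nonneg δ i j
  have e : ∀ x, ‖finiteEvolution S c t x‖ ^ 2 * pairWeight δ i j x =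
      ∑ α ∈ S, ∑ β ∈ S, phaseCoeff c α β t *
        (pairWeight δ i j x * (hermiteProd α x * hermiteProd β x)) := fun x => by
    rw [norm_finiteEvolution_sq, Finset.sum_mul]
    refine Finset.sum_congr rfl fun α _ => ?_
    rw [Finset.sum_mul]
    exact Finset.sum_congr rfl fun β _ => by ring
  have hi : ∀ α β, Integrable fun x => phaseCoeff c α β t *
      (pairWeight δ i j x * (hermiteProd α x * hermiteProd β x)) := fun α β =>
    (integrable_pairWeight_mul hδ hij α β).const_mul _
  have hint : Integrable fun x => ‖finiteEvolution S c t x‖ ^ 2 * pairWeight δ i j x := by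
    simp_rw [e]
    exact integrable_finsetSum _ fun α _ => integrable_finsetSum _ fun β _ => hi α β
  have hval : ∫ x, ‖finiteEvolution S c t x‖ ^ 2 * pairWeight δ i j x =
      finiteMass δ i j S c t := by
    simp_rw [e]
    rw [integral_finsetSum _ fun α _ => integrable_finsetSum _ fun β _ => hi α β, finiteMass]
    refine Finset.sum_congr rfl fun α _ => ?_
    rw [integral_finsetSum _ fun β _ => hi α β]
    refine Finset.sum_congr rfl fun β _ => ?_
    rw [integral_const_mul, pairMatrix]
  have hnn : ∀ x, 0 ≤ ‖finiteEvolution S c t x‖ ^ 2 * pairWeight δ i j x := fun x =>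
    mul_nonneg (sq_nonneg _) (hW x)
  refine ⟨hval ▸ integral_nonneg hnn, ?_⟩
  rw [← hval, ofReal_integral_eq_lintegral_ofReal hint (.of_forall hnn)]
  refine lintegral_congr fun x => ?_
  rw [ENNReal.ofReal_mul (sq_nonneg _), ENNReal.ofReal_pow (norm_nonneg _), ofReal_norm]

/-- The constant in the weighted estimate near the singular set. -/
noncomputable def nearConstant (δ : ℝ) : ℝ := 2 * Real.pi * (4 * ∫ y, nearWeight δ y) ^ 2 * 4

lemma nearConstant_nonneg (δ : ℝ) : 0 ≤ nearConstant δ := by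
  unfold nearConstant
  have := Real.pi_pos
  positivity

lemma integral_finiteMass_le {n : ℕ} {δ : ℝ} (hδ : δ < 1) {i j : Fin n} (hij : i ≠ j)
    (S : Finset (Fin n → ℕ)) (c : (Fin n → ℕ) → ℂ) :
    ∫ t in (0 : ℝ)..(2 * Real.pi), finiteMass δ i j S c t ≤
      nearConstant δ * ∑ α ∈ S, ‖c α‖ ^ 2 := by
  classical
  set R := (4 * ∫ y, nearWeight δ y) ^ 2 with hR
  have hR0 : 0 ≤ R := sq_nonneg _
  have hii : ∀ α β, IntervalIntegrable (fun t => phaseCoeff c α β t * pairMatrix δ i j α β)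
      volume 0 (2 * Real.pi) := fun α β =>
    ((continuous_phaseCoeff c α β).mul continuous_const).intervalIntegrable _ _
  have h1 : ∫ t in (0 : ℝ)..(2 * Real.pi), finiteMass δ i j S c t =
      ∑ α ∈ S, ∑ β ∈ S,
        (∫ t in (0 : ℝ)..(2 * Real.pi), phaseCoeff c α β t) * pairMatrix δ i j α β := by
    have hi : ∀ α, IntervalIntegrable (fun t => ∑ β ∈ S, phaseCoeff c α β t *
        pairMatrix δ i j α β) volume 0 (2 * Real.pi) := fun α =>
      (continuous_finsetSum _ fun β _ =>
        (continuous_phaseCoeff c α β).mul continuous_const).intervalIntegrable _ _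
    simp only [finiteMass]
    rw [intervalIntegral.integral_finsetSum fun α _ => hi α]
    refine Finset.sum_congr rfl fun α _ => ?_
    rw [intervalIntegral.integral_finsetSum fun β _ => hii α β]
    exact Finset.sum_congr rfl fun β _ => intervalIntegral.integral_mul_const _ _
  have h2 : ∀ α β, (∫ t in (0 : ℝ)..(2 * Real.pi), phaseCoeff c α β t) * pairMatrix δ i j α β ≤
      2 * Real.pi * R * (if IsResonant i j α β then
        (‖c α‖ * ‖c β‖) * (pairDecay i j α * pairDecay i j β) else 0) := by
    intro α β
    have hp := abs_integral_phaseCoeff_le c α β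
    by_cases hs : ∑ l, α l = ∑ l, β l
    · rw [if_pos hs] at hp
      by_cases hl : ∀ l, l ≠ i → l ≠ j → α l = β l
      · rw [if_pos (show IsResonant i j α β from ⟨hl, hs⟩)]
        refine (le_abs_self _).trans ?_
        rw [abs_mul]
        calc _ ≤ 2 * Real.pi * (‖c α‖ * ‖c β‖) * (R * (pairDecay i j α * pairDecay i j β)) :=
              mul_le_mul hp (abs_pairMatrix_le hδ hij α β) (abs_nonneg _) (by positivity)
          _ = _ := by ring
      · rw [if_neg (fun h : IsResonant i j α β => hl h.1)]
        push Not at hl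
        obtain ⟨l, hi, hj, hl⟩ := hl
        rw [pairMatrix_eq_zero δ hij hi hj hl]
        simp
    · rw [if_neg hs] at hp
      rw [abs_nonpos_iff.1 hp, if_neg (fun h : IsResonant i j α β => hs h.2)]
      simp
  rw [h1]
  calc _ ≤ ∑ α ∈ S, ∑ β ∈ S, 2 * Real.pi * R * (if IsResonant i j α β then
        (‖c α‖ * ‖c β‖) * (pairDecay i j α * pairDecay i j β) else 0) :=
        Finset.sum_le_sum fun α _ => Finset.sum_le_sum fun β _ => h2 α β
    _ = 2 * Real.pi * R * ∑ α ∈ S, ∑ β ∈ S, (if IsResonant i j α β then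
        (‖c α‖ * ‖c β‖) * (pairDecay i j α * pairDecay i j β) else 0) := by
        simp_rw [Finset.mul_sum]
    _ ≤ 2 * Real.pi * R * (4 * ∑ α ∈ S, ‖c α‖ ^ 2) :=
        mul_le_mul_of_nonneg_left (sum_resonant_le hij S fun α => ‖c α‖)
          (by have := Real.pi_pos; positivity)
    _ = _ := by rw [nearConstant]; ring

lemma lintegral_lintegral_finiteEvolution_le {n : ℕ} {δ : ℝ} (hδ : δ < 1) {i j : Fin n}
    (hij : i ≠ j) (S : Finset (Fin n → ℕ)) (c : (Fin n → ℕ) → ℂ) :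
    ∫⁻ t in Set.Icc (0 : ℝ) (2 * Real.pi), ∫⁻ x,
      ‖finiteEvolution S c t x‖ₑ ^ 2 * ENNReal.ofReal (pairWeight δ i j x) ≤
      ENNReal.ofReal (nearConstant δ * ∑ α ∈ S, ‖c α‖ ^ 2) := by
  simp_rw [(lintegral_pairWeight_finiteEvolution hδ hij S c _).2]
  rw [← ofReal_integral_eq_lintegral_ofReal
    (continuous_finiteMass δ i j S c).continuousOn.integrableOn_Icc
    (.of_forall fun t => (lintegral_pairWeight_finiteEvolution hδ hij S c t).1)]
  apply ENNReal.ofReal_le_ofReal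
  rw [integral_Icc_eq_integral_Ioc, ← intervalIntegral.integral_of_le Real.two_pi_pos.le]
  exact integral_finiteMass_le hδ hij S c

/-! ### Passage to general initial data -/

lemma lintegral_enorm_sq_L2 {n : ℕ} (v : L2 n) : ∫⁻ x, ‖v x‖ₑ ^ 2 = ‖v‖ₑ ^ 2 := by
  have h := eLpNorm_nnreal_pow_eq_lintegral (f := v) (μ := volume) (p := 2) (by norm_num)
  rw [Lp.enorm_def]
  simpa using h.symm

lemma hermitePropagator_sum {n : ℕ} (t : ℝ) (S : Finset (Fin n → ℕ)) (c : (Fin n → ℕ) → ℂ) :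
    hermitePropagator t (∑ α ∈ S, c α • hermiteL2 α) =
      ∑ α ∈ S, (hermitePhase t α * c α) • hermiteL2 α := by
  classical
  refine eq_of_inner_hermiteL2_eq fun β => ?_
  have ho := orthonormal_iff_ite.1 (orthonormal_hermiteL2 n)
  rw [inner_hermitePropagator, inner_sum, inner_sum]
  simp only [inner_smul_right, ho]
  simp

lemma coeFn_sum_smul_hermiteL2 {n : ℕ} (S : Finset (Fin n → ℕ)) (d : (Fin n → ℕ) → ℂ) :
    (∑ α ∈ S, d α • hermiteL2 α : L2 n) =ᵐ[volume]
      fun x => ∑ α ∈ S, d α * (hermiteProd α x : ℂ) := by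
  classical
  induction S using Finset.induction_on with
  | empty =>
    simp only [Finset.sum_empty]
    exact Lp.coeFn_zero ℂ 2 (volume : Measure (EuclideanSpace ℝ (Fin n)))
  | insert α S hα ih =>
    rw [Finset.sum_insert hα]
    filter_upwards [Lp.coeFn_add (d α • hermiteL2 α) (∑ β ∈ S, d β • hermiteL2 β), ih,
      Lp.coeFn_smul (d α) (hermiteL2 α), coeFn_hermiteL2 α] with x h1 h2 h3 h4
    rw [h1, Pi.add_apply, h2, h3, Pi.smul_apply, h4, Finset.sum_insert hα, smul_eq_mul]

/-- Sufficiently fast convergence in `L²` implies convergence almost everywhere. -/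
lemma ae_tendsto_of_tsum_enorm_sq_ne_top {n : ℕ} {u : L2 n} {v : ℕ → L2 n}
    (h : ∑' k, ‖u - v k‖ₑ ^ 2 ≠ ∞) :
    ∀ᵐ x, Filter.Tendsto (fun k => v k x) Filter.atTop (nhds (u x)) := by
  have hm : ∀ k, AEMeasurable (fun x => ‖(u - v k : L2 n) x‖ₑ ^ 2) := fun k =>
    (Lp.aestronglyMeasurable (u - v k)).enorm.pow_const 2
  have h1 : ∫⁻ x, ∑' k, ‖(u - v k : L2 n) x‖ₑ ^ 2 ≠ ∞ := by
    rw [lintegral_tsum hm]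
    simpa only [lintegral_enorm_sq_L2] using h
  filter_upwards [ae_lt_top' (AEMeasurable.tsum hm) h1,
    ae_all_iff.2 fun k => Lp.coeFn_sub u (v k)] with x hx hs
  have h2 := ENNReal.tendsto_atTop_zero_of_tsum_ne_top hx.ne
  have h3 := (ENNReal.continuous_rpow_const (y := (1 / 2 : ℝ))).tendsto 0 |>.comp h2
  rw [ENNReal.zero_rpow_of_pos (by norm_num)] at h3
  rw [tendsto_iff_edist_tendsto_0]
  refine h3.congr fun k => ?_
  rw [Function.comp_apply, hs k, Pi.sub_apply, edist_comm, edist_eq_enorm_sub,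
    ← ENNReal.rpow_natCast, ← ENNReal.rpow_mul]
  norm_num

lemma exists_finset_enorm_sub_sq_le {n : ℕ} (f : L2 n) (k : ℕ) :
    ∃ S : Finset (Fin n → ℕ),
      ‖f - ∑ α ∈ S, (inner ℂ (hermiteL2 α) f : ℂ) • hermiteL2 α‖ₑ ^ 2 ≤ 2⁻¹ ^ k := by
  have h := (hermiteBasis n).hasSum_repr f
  simp only [hermiteBasis_repr_apply, hermiteBasis_apply] at h
  have h1 : Filter.Tendsto (fun S : Finset (Fin n → ℕ) =>
      ‖f - ∑ α ∈ S, (inner ℂ (hermiteL2 α) f : ℂ) • hermiteL2 α‖ₑ ^ 2) Filter.atTop (nhds 0) := by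
    have h2 := (tendsto_iff_edist_tendsto_0.1 h)
    have h3 := ((ENNReal.continuous_pow 2).tendsto 0).comp h2
    rw [zero_pow two_ne_zero] at h3
    refine h3.congr fun S => ?_
    rw [Function.comp_apply, edist_comm, edist_eq_enorm_sub]
  have hpos : (0 : ℝ≥0∞) < 2⁻¹ ^ k := ENNReal.pow_pos (by norm_num) k
  obtain ⟨S, hS⟩ := (h1.eventually (gt_mem_nhds hpos)).exists
  exact ⟨S, hS.le⟩

/-- The weighted estimate near the singular set for arbitrary data, by approximation with finite
Hermite expansions and Fatou's lemma in space and time. -/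
lemma lintegral_lintegral_hermitePropagator_le {n : ℕ} {δ : ℝ} (hδ : δ < 1) {i j : Fin n}
    (hij : i ≠ j) (f : L2 n) :
    ∫⁻ t in Set.Icc (0 : ℝ) (2 * Real.pi), ∫⁻ x,
      ‖hermitePropagator t f x‖ₑ ^ 2 * ENNReal.ofReal (pairWeight δ i j x) ≤
      ENNReal.ofReal (nearConstant δ * ‖f‖ ^ 2) := by
  choose S hS using exists_finset_enorm_sub_sq_le f
  let c : (Fin n → ℕ) → ℂ := fun α => inner ℂ (hermiteL2 α) f
  let v : ℕ → ℝ → EuclideanSpace ℝ (Fin n) → ℂ := fun k t => finiteEvolution (S k) c t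
  let W : EuclideanSpace ℝ (Fin n) → ℝ≥0∞ := fun x => ENNReal.ofReal (pairWeight δ i j x)
  have hlim : ∀ t, ∀ᵐ x, Filter.Tendsto (fun k => v k t x) Filter.atTop
      (nhds (hermitePropagator t f x)) := by
    intro t
    have hsum : ∑' k, ‖hermitePropagator t f -
        hermitePropagator t (∑ α ∈ S k, c α • hermiteL2 α)‖ₑ ^ 2 ≠ ∞ := by
      have hle : ∀ k, ‖hermitePropagator t f -
          hermitePropagator t (∑ α ∈ S k, c α • hermiteL2 α)‖ₑ ^ 2 ≤ 2⁻¹ ^ k := by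
        intro k
        rw [← hermitePropagator_sub, ← ofReal_norm, norm_hermitePropagator, ofReal_norm]
        exact hS k
      refine ne_top_of_le_ne_top ?_ (ENNReal.tsum_le_tsum hle)
      rw [ENNReal.tsum_geometric, ENNReal.one_sub_inv_two, inv_inv]
      norm_num
    filter_upwards [ae_tendsto_of_tsum_enorm_sq_ne_top hsum, ae_all_iff.2 fun k =>
      coeFn_sum_smul_hermiteL2 (S k) fun α => hermitePhase t α * c α] with x hx hk
    refine hx.congr fun k => ?_
    rw [hermitePropagator_sum, hk k]
    rfl
  have hx : ∀ t, ∫⁻ x, ‖hermitePropagator t f x‖ₑ ^ 2 * W x ≤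
      Filter.liminf (fun k => ∫⁻ x, ‖v k t x‖ₑ ^ 2 * W x) Filter.atTop := by
    intro t
    refine le_trans (lintegral_mono_ae ?_) (lintegral_liminf_le fun k =>
      ((continuous_finiteEvolution (S k) c t).measurable.enorm.pow_const 2).mul
        (measurable_pairWeight δ i j).ennreal_ofReal)
    filter_upwards [hlim t] with x hx
    have h1 := ((ENNReal.continuous_pow 2).tendsto _).comp ((continuous_enorm.tendsto _).comp hx)
    have h2 := ENNReal.Tendsto.mul_const (b := W x) h1 (Or.inr ENNReal.ofReal_ne_top)
    exact h2.liminf_eq.ge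
  have hmeas : ∀ k, Measurable fun t => ∫⁻ x, ‖v k t x‖ₑ ^ 2 * W x := by
    intro k
    have e : (fun t => ∫⁻ x, ‖v k t x‖ₑ ^ 2 * W x) =
        fun t => ENNReal.ofReal (finiteMass δ i j (S k) c t) :=
      funext fun t => (lintegral_pairWeight_finiteEvolution hδ hij (S k) c t).2
    rw [e]
    exact (continuous_finiteMass δ i j (S k) c).measurable.ennreal_ofReal
  calc _ ≤ ∫⁻ t in Set.Icc (0 : ℝ) (2 * Real.pi),
        Filter.liminf (fun k => ∫⁻ x, ‖v k t x‖ₑ ^ 2 * W x) Filter.atTop :=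
        lintegral_mono fun t => hx t
    _ ≤ Filter.liminf (fun k => ∫⁻ t in Set.Icc (0 : ℝ) (2 * Real.pi),
        ∫⁻ x, ‖v k t x‖ₑ ^ 2 * W x) Filter.atTop := lintegral_liminf_le hmeas
    _ ≤ Filter.liminf (fun _ : ℕ => ENNReal.ofReal (nearConstant δ * ‖f‖ ^ 2)) Filter.atTop := by
        refine Filter.liminf_le_liminf (.of_forall fun k => ?_)
        refine (lintegral_lintegral_finiteEvolution_le hδ hij (S k) c).trans ?_
        refine ENNReal.ofReal_le_ofReal (mul_le_mul_of_nonneg_left ?_ (nearConstant_nonneg δ))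
        exact sum_le_hasSum _ (fun _ _ => sq_nonneg _) (hasSum_norm_sq_inner_hermiteL2 f)
    _ = _ := Filter.liminf_const _

/-! ### The weighted space-time estimate -/

lemma ae_coord_ne_zero {n : ℕ} (i : Fin n) : ∀ᵐ x : EuclideanSpace ℝ (Fin n), x i ≠ 0 := by
  have h := ((Measure.quasiMeasurePreserving_eval (fun _ : Fin n => (volume : Measure ℝ)) i).comp
    (PiLp.volume_preserving_ofLp (Fin n)).quasiMeasurePreserving).ae (Measure.ae_ne volume (0 : ℝ))
  exact h

/-- Since `a² + b² ≥ |a| |b|`, the singular weight is dominated by a product of weights in separate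
variables. -/
lemma inv_weight_le {δ a b r : ℝ} (hδ : 0 ≤ δ) (ha : a ≠ 0) (hb : b ≠ 0)
    (hr : a ^ 2 + b ^ 2 ≤ r) :
    (r ^ δ)⁻¹ ≤ 1 + nearWeight δ a * nearWeight δ b := by
  have ha' := abs_pos.2 ha
  have hb' := abs_pos.2 hb
  have hn : 0 ≤ nearWeight δ a * nearWeight δ b :=
    mul_nonneg (nearWeight_nonneg _ _) (nearWeight_nonneg _ _)
  by_cases h : |a| ≤ 1 ∧ |b| ≤ 1
  · have h1 : |a| * |b| ≤ r := by
      nlinarith [sq_nonneg (|a| - |b|), sq_abs a, sq_abs b, mul_pos ha' hb']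
    have h2 : (|a| * |b|) ^ δ ≤ r ^ δ := Real.rpow_le_rpow (by positivity) h1 hδ
    have h3 : nearWeight δ a * nearWeight δ b = ((|a| * |b|) ^ δ)⁻¹ := by
      rw [nearWeight, Set.indicator_of_mem (Set.mem_Icc.2 (abs_le.1 h.1)),
        Set.indicator_of_mem (Set.mem_Icc.2 (abs_le.1 h.2)),
        ← Real.mul_rpow ha'.le hb'.le, Real.rpow_neg (by positivity)]
    rw [h3]
    have := inv_anti₀ (Real.rpow_pos_of_pos (mul_pos ha' hb') δ) h2
    linarith
  · have h1 : 1 ≤ r := by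
      rw [not_and_or, not_le, not_le] at h
      rcases h with h | h
      · nlinarith [sq_abs a, sq_nonneg b]
      · nlinarith [sq_abs b, sq_nonneg a]
    have := inv_le_one_of_one_le₀ (Real.one_le_rpow h1 hδ)
    linarith

lemma weightedSpaceTimeIntegral_le {n : ℕ} {δ : ℝ} (hδ0 : 0 ≤ δ) (hδ : δ < 1) {i j : Fin n}
    (hij : i ≠ j) {w : EuclideanSpace ℝ (Fin n) → ℝ} (hw : ∀ x, x i ^ 2 + x j ^ 2 ≤ w x)
    {f : L2 n} {u : ℝ → L2 n} (hu : IsSchrodingerSolution f u) :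
    weightedSpaceTimeIntegral u w δ ≤
      (2 * Real.pi + nearConstant δ).toNNReal * ‖f‖ₑ ^ 2 := by
  have h1 : ∀ t, ∫⁻ x, ‖u t x‖ₑ ^ 2 / ENNReal.ofReal (w x ^ δ) ≤
      ‖f‖ₑ ^ 2 + ∫⁻ x, ‖hermitePropagator t f x‖ₑ ^ 2 *
        ENNReal.ofReal (pairWeight δ i j x) := by
    intro t
    rw [hu.eq_hermitePropagator t]
    have hf : ‖f‖ₑ ^ 2 = ∫⁻ x, ‖hermitePropagator t f x‖ₑ ^ 2 := by
      rw [lintegral_enorm_sq_L2, ← ofReal_norm, ← ofReal_norm, norm_hermitePropagator]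
    rw [hf, ← lintegral_add_left' ((Lp.aestronglyMeasurable _).enorm.pow_const 2)]
    refine lintegral_mono_ae ?_
    -- off this null set the weight is positive, so that no division by zero occurs
    filter_upwards [ae_coord_ne_zero i, ae_coord_ne_zero j] with x hi hj
    have hpos : 0 < w x := lt_of_lt_of_le (by positivity) (hw x)
    rw [div_eq_mul_inv, ← ENNReal.ofReal_inv_of_pos (Real.rpow_pos_of_pos hpos δ)]
    calc _ ≤ ‖hermitePropagator t f x‖ₑ ^ 2 * ENNReal.ofReal (1 + pairWeight δ i j x) := by
          gcongr
          exact inv_weight_le hδ0 hi hj (hw x)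
      _ = _ := by
          rw [ENNReal.ofReal_add zero_le_one (pairWeight_nonneg _ _ _ _), mul_add,
            ENNReal.ofReal_one, mul_one]
  rw [weightedSpaceTimeIntegral]
  refine (lintegral_mono h1).trans ?_
  rw [lintegral_add_left measurable_const, setLIntegral_const, Real.volume_Icc, sub_zero]
  have h2 := lintegral_lintegral_hermitePropagator_le hδ hij f
  have h3 : ENNReal.ofReal (nearConstant δ * ‖f‖ ^ 2) =
      ENNReal.ofReal (nearConstant δ) * ‖f‖ₑ ^ 2 := by
    rw [ENNReal.ofReal_mul (nearConstant_nonneg δ), ENNReal.ofReal_pow (norm_nonneg _), ofReal_norm]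
  calc _ ≤ ‖f‖ₑ ^ 2 * ENNReal.ofReal (2 * Real.pi) + ENNReal.ofReal (nearConstant δ) * ‖f‖ₑ ^ 2 :=
        add_le_add_right (h2.trans_eq h3) _
    _ = ENNReal.ofReal (2 * Real.pi + nearConstant δ) * ‖f‖ₑ ^ 2 := by
        rw [ENNReal.ofReal_add Real.two_pi_pos.le (nearConstant_nonneg δ)]
        ring

theorem mainTheorem5 (n : ℕ) (hn : 2 ≤ n) :
    (∀ f : L2 n, ∃! u : ℝ → L2 n, IsSchrodingerSolution f u) ∧
    ∀ δ : ℝ, 0 ≤ δ → δ < 1 →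
      (∃ C : ℝ≥0, ∀ (f : L2 n) (u : ℝ → L2 n), IsSchrodingerSolution f u →
        weightedSpaceTimeIntegral u
          (fun x => x ⟨0, by omega⟩ ^ 2 + x ⟨1, by omega⟩ ^ 2) δ ≤ C * ‖f‖ₑ ^ 2) ∧
      (∃ C : ℝ≥0, ∀ i j k : Fin n, i ≠ j → j ≠ k → i ≠ k →
        ∀ (f : L2 n) (u : ℝ → L2 n), IsSchrodingerSolution f u →
        weightedSpaceTimeIntegral u
          (fun x => x i ^ 2 + x j ^ 2 + x k ^ 2) δ ≤ C * ‖f‖ₑ ^ 2) := by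
  refine ⟨fun f => ⟨_, isSchrodingerSolution_hermitePropagator f, fun u hu =>
    funext fun t => hu.eq_hermitePropagator t⟩, fun δ hδ0 hδ => ⟨
    ⟨(2 * Real.pi + nearConstant δ).toNNReal, fun f u hu => ?_⟩,
    ⟨(2 * Real.pi + nearConstant δ).toNNReal, fun i j k hij _ _ f u hu => ?_⟩⟩⟩
  · exact weightedSpaceTimeIntegral_le hδ0 hδ (by simp) (fun x => le_rfl) hu
  · exact weightedSpaceTimeIntegral_le hδ0 hδ hij
      (fun x => le_add_of_nonneg_right (sq_nonneg (x k))) hu
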